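/- Let $\mathbb K$ be a field of characteristic $0$. Let $(L,[\cdot,\cdot,\cdot])$ be a Lie triple system over $\mathbb K$, that is, a vector space with a trilinear bracket such that $[x,x,y]=0$, $[x,y,z]+[y,z,x]+[z,x,y]=0$ and $[x,y,[z,t,e]]=[[x,y,z],t,e]+[z,[x,y,t],e]+[z,t,[x,y,e]]$. Let $\theta:L\otimes L\to\mathrm{End}(M)$ be a representation: with $D(x,y)=\theta(y,x)-\theta(x,y)$, $$\theta(z,t)\theta(x,y)-\theta(y,t)\theta(x,z)-\theta(x,[y,z,t])+D(y,z)\theta(x,t)=0,$$ $$\theta(z,t)D(x,y)-D(x,y)\theta(z,t)+\theta([x,y,z],t)+\theta(z,[x,y,t])=0 .$$ Let $\mathcal H:L^{\otimes3}\to M$ be a Yamaguti $3$-cocycle: $\mathcal H(x,x,y)=0$, the cyclic sum of $\mathcal H(x,y,z)$ vanishes, and $\delta^3\mathcal H=0$, with $\delta$ as below (for $L$, $M$, $\theta$). Let $T:M\to L$ be a generalized Reynolds operator, i.e. a linear map with $[Tu,Tv,Tw]=T\big([u,v,w]_T\big)$ for all $u,v,w\in M$, where $$[u,v,w]_T=\theta(Tv,Tw)u-\theta(Tu,Tw)v+D(Tu,Tv)w+\mathcal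 H(Tu,Tv,Tw).$$ Put $\theta_T(u,v)x=[x,Tu,Tv]-T\big(D(x,Tu)v-\theta(x,Tv)u+\mathcal H(x,Tu,Tv)\big)$ and $D_T(u,v)=\theta_T(v,u)-\theta_T(u,v)$. *The Yamaguti coboundary $\Lambda_T$.* For $n\ge1$ and a multilinear $f:M^{2n-1}\to L$, $$\begin{aligned}\Lambda_T f(v_1,\dots,v_{2n+1})={}&\theta_T(v_{2n},v_{2n+1})f(v_1,\dots,v_{2n-1})-\theta_T(v_{2n-1},v_{2n+1})f(v_1,\dots,v_{2n-2},v_{2n})\\&+\sum_{k=1}^n(-1)^{n+k}D_T(v_{2k-1},v_{2k})f(v_1,\dots,\widehat{v_{2k-1}},\widehat{v_{2k}},\dots,v_{2n+1})\\&+\sum_{k=1}^n\sum_{j=2k+1}^{2n+1}(-1)^{n+k+1}f(v_1,\dots,\widehat{v_{2k-1}},\widehat{v_{2k}},\dots,[v_{2k-1},v_{2k},v_j]_T,\dots,v_{2n+1}).\end{aligned}$$ *The differential $d_T$.* For a vector space $V$ let $C^p(V,V)=\mathrm{Hom}((V\otimes V)^{\otimes p}\otimes V,V)$. For $P\in C^p(V,V)$,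 $Q\in C^q(V,V)$ let $[P,Q]=P\circ Q-(-1)^{pq}Q\circ P$, where for $\mathfrak X_i=x_i\otimes y_i$ $$\begin{aligned}(P\circ Q)(\mathfrak X_1,\dots,\mathfrak X_{p+q},x)={}&\sum_{k=1}^p(-1)^{(k-1)q}\sum_{\sigma\in S(k-1,q)}(-1)^\sigma\Big(P(\mathfrak X_{\sigma(1)},\dots,\mathfrak X_{\sigma(k-1)},Q_\sigma(x_{k+q})\otimes y_{k+q},\mathfrak X_{k+q+1},\dots,x)\\&\qquad+P(\mathfrak X_{\sigma(1)},\dots,\mathfrak X_{\sigma(k-1)},x_{k+q}\otimes Q_\sigma(y_{k+q}),\mathfrak X_{k+q+1},\dots,x)\Big)\\&+\sum_{\sigma\in S(p,q)}(-1)^{pq}(-1)^\sigma P\big(\mathfrak X_{\sigma(1)},\dots,\mathfrak X_{\sigma(p)},Q(\mathfrak X_{\sigma(p+1)},\dots,\mathfrak X_{\sigma(p+q)},x)\big),\end{aligned}$$ with $Q_\sigma(z)=Q(\mathfrak X_{\sigma(k)},\dots,\mathfrak X_{\sigma(k+q-1)},z)$ and $S(a,b)$ the set of $(a,b)$-shuffles.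 Take $V=L\oplus M$; regard maps $M^{2p+1}\to L$ as elements of $C^p(V,V)$ through the projection $V\to M$ and the inclusion $L\to V$. Let $\pi+\theta,\mathcal H\in C^1(V,V)$ be the maps sending $(x+u,y+v,z+w)$ to $[x,y,z]+\theta(y,z)u-\theta(x,z)v+D(x,y)w$ and to $\mathcal H(x,y,z)$, and put $$l_3(P,Q,R)=[[[\pi+\theta,P],Q],R],\qquad l_4(P,Q,R,S)=[[[[\mathcal H,P],Q],R],S],$$ $$d_T=l_1^T=\tfrac12\,l_3(T,T,\cdot)+\tfrac16\,l_4(T,T,T,\cdot),$$ the unary bracket of the $L_\infty$-algebra with brackets $l_3,l_4$ twisted by $T$. **Theorem.** $(M,[\cdot,\cdot,\cdot]_T)$ is a Lie triple system, $(L,\theta_T)$ is a representation of it (so $\Lambda_T$ is the Yamaguti coboundary of $(M,[\cdot,\cdot,\cdot]_T)$ with coefficients in $(L,\theta_T)$), and for every $n\ge1$ and every multilinear $f:M^{2n-1}\to L$ the cochain $l_1^T(f)$ on $L\oplus M$ again comes from a map $M^{2n+1}\to L$, namely $$d_T(f)=\Lambda_T(f).$$ Consequently, on the Yamaguti cochains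 $\{f:\ f(\dots,x,x,y)=0,\ \circlearrowleft_{x,y,z}f(\dots,x,y,z)=0\}$ (conditions on the last three arguments; no condition on $f:M\to L$), and likewise on the subspace of those cochains that are skew-symmetric in each pair $(v_{2k-1},v_{2k})$, the operators $d_T$ and $\Lambda_T$ have the same cocycles $Z^{2n-1}$, the same coboundaries $B^{2n-1}$ ($B^1=0$), and the identity on cocycles induces an isomorphism of the cohomology spaces $Z^{2n-1}/B^{2n-1}$ for all $n\ge1$. -/

import Mathlib

open scoped TensorProduct

namespace LTS

/-! ### Trilinear maps -/

section Trilinear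

variable {K A B C D : Type*} [Field K]
  [AddCommGroup A] [Module K A] [AddCommGroup B] [Module K B]
  [AddCommGroup C] [Module K C] [AddCommGroup D] [Module K D]

/-- A function of three variables that is linear in each of them, as a curried linear map. -/
def mk₃ (f : A → B → C → D)
    (a₁ : ∀ x x' y z, f (x + x') y z = f x y z + f x' y z)
    (s₁ : ∀ (c : K) x y z, f (c • x) y z = c • f x y z)
    (a₂ : ∀ x y y' z, f x (y + y') z = f x y z + f x y' z)
    (s₂ : ∀ (c : K) x y z, f x (c • y) z = c • f x y z)
    (a₃ : ∀ x y z z', f x y (z + z') = f x y z + f x y z')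
    (s₃ : ∀ (c : K) x y z, f x y (c • z) = c • f x y z) :
    A →ₗ[K] B →ₗ[K] C →ₗ[K] D :=
  LinearMap.mk₂ K (fun x y => { toFun := f x y, map_add' := a₃ x y, map_smul' := fun c => s₃ c x y })
    (fun x x' y => LinearMap.ext fun z => a₁ x x' y z)
    (fun c x y => LinearMap.ext fun z => s₁ c x y z)
    (fun x y y' => LinearMap.ext fun z => a₂ x y y' z)
    (fun c x y => LinearMap.ext fun z => s₂ c x y z)

@[simp] theorem mk₃_apply (f : A → B → C → D) (a₁ s₁ a₂ s₂ a₃ s₃) (x : A) (y : B) (z : C) :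
    mk₃ (K := K) f a₁ s₁ a₂ s₂ a₃ s₃ x y z = f x y z := rfl

end Trilinear

/-! ### Lie triple systems, representations, cocycles -/

section Basic

variable {K L M : Type*} [Field K] [AddCommGroup L] [Module K L] [AddCommGroup M] [Module K M]

/-- The trilinear bracket `br` is a Lie triple system structure on `L`. -/
structure IsLieTripleSystem (br : L →ₗ[K] L →ₗ[K] L →ₗ[K] L) : Prop where
  skew : ∀ x y, br x x y = 0
  cyclic : ∀ x y z, br x y z + br y z x + br z x y = 0
  derivation : ∀ x y z t e,
    br x y (br z t e) = br (br x y z) t e + br z (br x y t) e + br z t (br x y e)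

/-- `D(x, y) = θ(y, x) - θ(x, y)`. -/
def dOp (θ : L →ₗ[K] L →ₗ[K] M →ₗ[K] M) : L →ₗ[K] L →ₗ[K] M →ₗ[K] M := θ.flip - θ

@[simp] theorem dOp_apply (θ : L →ₗ[K] L →ₗ[K] M →ₗ[K] M) (x y : L) (u : M) :
    dOp θ x y u = θ y x u - θ x y u := rfl

/-- `θ` is a representation on `M` of the Lie triple system `(L, br)`. -/
structure IsRepresentation (br : L →ₗ[K] L →ₗ[K] L →ₗ[K] L)
    (θ : L →ₗ[K] L →ₗ[K] M →ₗ[K] M) : Prop where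
  rep₁ : ∀ x y z t u, θ z t (θ x y u) - θ y t (θ x z u) - θ x (br y z t) u
    + dOp θ y z (θ x t u) = 0
  rep₂ : ∀ x y z t u, θ z t (dOp θ x y u) - dOp θ x y (θ z t u) + θ (br x y z) t u
    + θ z (br x y t) u = 0

/-- `H` is a Yamaguti `3`-cocycle of `(L, br)` with coefficients in `(M, θ)`. -/
structure IsThreeCocycle (br : L →ₗ[K] L →ₗ[K] L →ₗ[K] L) (θ : L →ₗ[K] L →ₗ[K] M →ₗ[K] M)
    (H : L →ₗ[K] L →ₗ[K] L →ₗ[K] M) : Prop where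
  skew : ∀ x y, H x x y = 0
  cyclic : ∀ x y z, H x y z + H y z x + H z x y = 0
  cocycle : ∀ x₁ x₂ y₁ y₂ y₃,
    H x₁ x₂ (br y₁ y₂ y₃) + dOp θ x₁ x₂ (H y₁ y₂ y₃)
        - H (br x₁ x₂ y₁) y₂ y₃ - H y₁ (br x₁ x₂ y₂) y₃
      = H y₁ y₂ (br x₁ x₂ y₃) + θ y₂ y₃ (H x₁ x₂ y₁) - θ y₁ y₃ (H x₁ x₂ y₂)
        + dOp θ y₁ y₂ (H x₁ x₂ y₃)

/-- `T : M → L` is a generalized Reynolds operator on `(L, br, θ)`, relative to `H`. -/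
def IsGeneralizedReynolds (br : L →ₗ[K] L →ₗ[K] L →ₗ[K] L) (θ : L →ₗ[K] L →ₗ[K] M →ₗ[K] M)
    (H : L →ₗ[K] L →ₗ[K] L →ₗ[K] M) (T : M →ₗ[K] L) : Prop :=
  ∀ u v w, br (T u) (T v) (T w) =
    T (dOp θ (T u) (T v) w + θ (T v) (T w) u - θ (T u) (T w) v + H (T u) (T v) (T w))

/-- The bracket `[u, v, w]_T` on `M`. -/
def inducedBracket (θ : L →ₗ[K] L →ₗ[K] M →ₗ[K] M) (H : L →ₗ[K] L →ₗ[K] L →ₗ[K] M)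
    (T : M →ₗ[K] L) : M →ₗ[K] M →ₗ[K] M →ₗ[K] M :=
  mk₃ (fun u v w => θ (T v) (T w) u - θ (T u) (T w) v + dOp θ (T u) (T v) w
      + H (T u) (T v) (T w))
    (by intros; simp; abel) (by intros; simp [smul_add, smul_sub])
    (by intros; simp; abel) (by intros; simp [smul_add, smul_sub])
    (by intros; simp; abel) (by intros; simp [smul_add, smul_sub])

/-- `θ_T(u, v) x = [x, Tu, Tv] - T (D(x, Tu) v - θ(x, Tv) u + H(x, Tu, Tv))`. -/
def inducedRep (br : L →ₗ[K] L →ₗ[K] L →ₗ[K] L) (θ : L →ₗ[K] L →ₗ[K] M →ₗ[K] M)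
    (H : L →ₗ[K] L →ₗ[K] L →ₗ[K] M) (T : M →ₗ[K] L) : M →ₗ[K] M →ₗ[K] L →ₗ[K] L :=
  mk₃ (fun u v x => br x (T u) (T v)
      - T (dOp θ x (T u) v - θ x (T v) u + H x (T u) (T v)))
    (by intros; simp; abel) (by intros; simp [smul_add, smul_sub])
    (by intros; simp; abel) (by intros; simp [smul_add, smul_sub])
    (by intros; simp; abel) (by intros; simp [smul_add, smul_sub])

end Basic

/-! ### Cochains and the Yamaguti coboundary -/

/-- Degree `n` cochains `Hom((⊗²V)^{⊗n} ⊗ V, W)`, that is, `(2n+1)`-linear maps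
`V × ⋯ × V → W` whose first `2n` arguments are grouped into `n` pairs. -/
abbrev Cochain (K V W : Type*) [Field K] [AddCommGroup V] [Module K V]
    [AddCommGroup W] [Module K W] (n : ℕ) :=
  MultilinearMap K (fun _ : Fin n => V ⊗[K] V) (V →ₗ[K] W)

section Yamaguti

variable {K V W : Type*} [Field K] [AddCommGroup V] [Module K V] [AddCommGroup W] [Module K W]

/-- `g · (x ⊗ y) = g x ⊗ y + x ⊗ g y`. -/
def actPair : (V →ₗ[K] V) →ₗ[K] (V ⊗[K] V →ₗ[K] V ⊗[K] V) :=
  LinearMap.rTensorHom V + LinearMap.lTensorHom V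

@[simp] theorem actPair_tmul (g : V →ₗ[K] V) (x y : V) :
    actPair (K := K) g (x ⊗ₜ y) = g x ⊗ₜ y + x ⊗ₜ g y := rfl

/-- Substituting the linear map `g` in the `j`-th pair of arguments of a cochain. -/
def substPair {n : ℕ} (φ : Cochain K V W n) (j : Fin n) :
    (V ⊗[K] V →ₗ[K] V ⊗[K] V) →ₗ[K] Cochain K V W n :=
  LinearMap.applyₗ φ ∘ₗ (MultilinearMap.compLinearMapMultilinear (R := K)
    (M₁ := fun _ : Fin n => V ⊗[K] V) (M₁' := fun _ : Fin n => V ⊗[K] V)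
    (M₂ := V →ₗ[K] W)).toLinearMap (fun _ => LinearMap.id) j

theorem substPair_apply {n : ℕ} (φ : Cochain K V W n) (j : Fin n)
    (g : V ⊗[K] V →ₗ[K] V ⊗[K] V) (X : Fin n → V ⊗[K] V) :
    substPair φ j g X = φ (Function.update X j (g (X j))) := by
  simp only [substPair, LinearMap.comp_apply, MultilinearMap.toLinearMap_apply,
    LinearMap.applyₗ_apply_apply, MultilinearMap.compLinearMapMultilinear_apply,
    MultilinearMap.compLinearMapₗ_apply, MultilinearMap.compLinearMap_apply]
  congr 1
  funext i
  by_cases h : i = j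
  · subst h; simp
  · simp [Function.update_of_ne h]

/-- The part of the Yamaguti coboundary in which the last pair `x ⊗ y` acts through `θ`:
`z ↦ θ(y, z) g(x) - θ(x, z) g(y)`. -/
def thetaPart (θ : V →ₗ[K] V →ₗ[K] W →ₗ[K] W) :
    V ⊗[K] V →ₗ[K] (V →ₗ[K] W) →ₗ[K] (V →ₗ[K] W) :=
  TensorProduct.lift (mk₃
    (fun x y g => (θ y).flip (g x) - (θ x).flip (g y))
    (by intros; ext; simp; abel) (by intros; ext; simp [smul_sub])
    (by intros; ext; simp; abel) (by intros; ext; simp [smul_sub])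
    (by intros; ext; simp; abel) (by intros; ext; simp [smul_sub]))

@[simp] theorem thetaPart_tmul (θ : V →ₗ[K] V →ₗ[K] W →ₗ[K] W) (x y z : V) (g : V →ₗ[K] W) :
    thetaPart θ (x ⊗ₜ y) g z = θ y z (g x) - θ x z (g y) := rfl

/-- Postcomposing and precomposing a cochain in its last argument. -/
def postComp {n : ℕ} (φ : Cochain K V W n) :
    ((V →ₗ[K] W) →ₗ[K] (V →ₗ[K] W)) →ₗ[K] Cochain K V W n where
  toFun E := E.compMultilinearMap φ
  map_add' _ _ := rfl
  map_smul' _ _ := rfl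

theorem postComp_apply {n : ℕ} (φ : Cochain K V W n)
    (E : (V →ₗ[K] W) →ₗ[K] (V →ₗ[K] W)) (X : Fin n → V ⊗[K] V) : postComp φ E X = E (φ X) := rfl

/-- The contribution of the pair `X_k` to the Yamaguti coboundary of `φ`, before the sign
`(-1)^{n+k}`: `D(X_k) φ(…)`, minus `φ` with one of the later arguments `v` replaced by `[X_k, v]`.
Here `j` runs over the pairs that come after the `k`-th one. -/
def pairPart (br : V →ₗ[K] V →ₗ[K] V →ₗ[K] V) (θ : V →ₗ[K] V →ₗ[K] W →ₗ[K] W) {n : ℕ}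
    (φ : Cochain K V W n) (k : Fin (n + 1)) : V ⊗[K] V →ₗ[K] Cochain K V W n :=
  postComp φ ∘ₗ LinearMap.llcomp K V W W ∘ₗ TensorProduct.lift (dOp θ)
    - (∑ j ∈ Finset.univ.filter (fun j : Fin n => k < k.succAbove j),
        substPair φ j ∘ₗ actPair ∘ₗ TensorProduct.lift br)
    - postComp φ ∘ₗ (LinearMap.llcomp K V V W).flip ∘ₗ TensorProduct.lift br

theorem pairPart_apply (br : V →ₗ[K] V →ₗ[K] V →ₗ[K] V) (θ : V →ₗ[K] V →ₗ[K] W →ₗ[K] W) {n : ℕ}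
    (φ : Cochain K V W n) (k : Fin (n + 1)) (Y : V ⊗[K] V) (X : Fin n → V ⊗[K] V) (z : V) :
    pairPart br θ φ k Y X z = TensorProduct.lift (dOp θ) Y (φ X z)
      - ∑ j ∈ Finset.univ.filter (fun j : Fin n => k < k.succAbove j),
          φ (Function.update X j (actPair (TensorProduct.lift br Y) (X j))) z
      - φ X (TensorProduct.lift br Y z) := by
  simp only [pairPart, LinearMap.sub_apply, sub_apply, LinearMap.sum_apply,
    sum_apply, LinearMap.comp_apply, substPair_apply]
  rfl

/-- The Yamaguti coboundary of a cochain of degree `n`, that is, in `2n+1` arguments. Its literal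
formula on elements is `yamagutiCoboundary_apply_tmul`. -/
def yamagutiCoboundary (br : V →ₗ[K] V →ₗ[K] V →ₗ[K] V) (θ : V →ₗ[K] V →ₗ[K] W →ₗ[K] W) (n : ℕ) :
    Cochain K V W n →ₗ[K] Cochain K V W (n + 1) where
  toFun φ := LinearMap.uncurryMid (Fin.last n) (postComp φ ∘ₗ thetaPart θ)
    + ∑ k : Fin (n + 1), (-1 : K) ^ (n + (k : ℕ)) • LinearMap.uncurryMid k (pairPart br θ φ k)
  map_add' φ ψ := by
    ext X z
    simp only [add_apply, LinearMap.add_apply, sum_apply, LinearMap.sum_apply,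
      smul_apply, LinearMap.smul_apply, LinearMap.uncurryMid_apply, pairPart_apply,
      LinearMap.comp_apply, postComp_apply, map_add, Finset.sum_add_distrib]
    rw [add_add_add_comm, ← Finset.sum_add_distrib]
    congr 1
    refine Finset.sum_congr rfl fun k _ => ?_
    rw [← smul_add]
    congr 1
    abel
  map_smul' c φ := by
    ext X z
    simp only [add_apply, LinearMap.add_apply, sum_apply, LinearMap.sum_apply,
      smul_apply, LinearMap.smul_apply, LinearMap.uncurryMid_apply, pairPart_apply,
      LinearMap.comp_apply, postComp_apply, map_smul, RingHom.id_apply, ← Finset.smul_sum,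
      ← smul_sub, smul_add]
    congr 1
    rw [Finset.smul_sum]
    exact Finset.sum_congr rfl fun k _ => smul_comm _ _ _

/-- The Yamaguti coboundary evaluated on `v_1, …, v_{2n+3}`, where
`(x_k, y_k) = (v_{2k+1}, v_{2k+2})` for `0 ≤ k ≤ n` and `z = v_{2n+3}`. -/
theorem yamagutiCoboundary_apply_tmul (br : V →ₗ[K] V →ₗ[K] V →ₗ[K] V)
    (θ : V →ₗ[K] V →ₗ[K] W →ₗ[K] W) (n : ℕ) (φ : Cochain K V W n)
    (x y : Fin (n + 1) → V) (z : V) :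
    yamagutiCoboundary br θ n φ (fun i => x i ⊗ₜ y i) z =
      θ (y (Fin.last n)) z (φ (fun i : Fin n => x i.castSucc ⊗ₜ y i.castSucc) (x (Fin.last n)))
      - θ (x (Fin.last n)) z (φ (fun i : Fin n => x i.castSucc ⊗ₜ y i.castSucc) (y (Fin.last n)))
      + ∑ k : Fin (n + 1), (-1 : K) ^ (n + (k : ℕ)) •
          dOp θ (x k) (y k) (φ (fun i => x (k.succAbove i) ⊗ₜ y (k.succAbove i)) z)
      + ∑ k : Fin (n + 1), (-1 : K) ^ (n + (k : ℕ) + 1) •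
          ((∑ j ∈ Finset.Ioi k,
            (φ (fun i => Function.update x j (br (x k) (y k) (x j)) (k.succAbove i)
                  ⊗ₜ y (k.succAbove i)) z
              + φ (fun i => x (k.succAbove i)
                  ⊗ₜ Function.update y j (br (x k) (y k) (y j)) (k.succAbove i)) z))
            + φ (fun i => x (k.succAbove i) ⊗ₜ y (k.succAbove i)) (br (x k) (y k) z)) := by
  have he : ∀ k : Fin (n + 1), k.removeNth (fun i => x i ⊗ₜ[K] y i)
      = fun i => x (k.succAbove i) ⊗ₜ[K] y (k.succAbove i) := fun _ => rfl
  have hsub : ∀ k : Fin (n + 1), ∀ g : V →ₗ[K] V,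
      ∑ j ∈ Finset.univ.filter (fun j : Fin n => k < k.succAbove j),
        φ (Function.update (fun i => x (k.succAbove i) ⊗ₜ y (k.succAbove i)) j
          (actPair g (x (k.succAbove j) ⊗ₜ y (k.succAbove j)))) z
      = ∑ j ∈ Finset.Ioi k,
          (φ (fun i => Function.update x j (g (x j)) (k.succAbove i) ⊗ₜ y (k.succAbove i)) z
            + φ (fun i => x (k.succAbove i) ⊗ₜ Function.update y j (g (y j)) (k.succAbove i)) z) := by
    intro k g
    symm
    have himg : Finset.Ioi k = (Finset.univ.filter (fun j : Fin n => k < k.succAbove j)).map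
        k.succAboveEmb := by
      ext j
      simp only [Finset.mem_Ioi, Finset.mem_map, Finset.mem_filter, Finset.mem_univ, true_and]
      constructor
      · intro h
        obtain ⟨i, rfl⟩ := Fin.exists_succAbove_eq h.ne'
        exact ⟨i, h, rfl⟩
      · rintro ⟨i, h, rfl⟩
        exact h
    rw [himg, Finset.sum_map]
    refine Finset.sum_congr rfl fun j _ => ?_
    rw [actPair_tmul, MultilinearMap.map_update_add, LinearMap.add_apply]
    congr 3
    · funext i
      by_cases h : i = j
      · subst h; simp
      · have h2 : k.succAbove i ≠ k.succAbove j := fun e => h (Fin.succAbove_right_injective e)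
        simp [Function.update_of_ne h, Function.update_of_ne h2]
    · funext i
      by_cases h : i = j
      · subst h; simp
      · have h2 : k.succAbove i ≠ k.succAbove j := fun e => h (Fin.succAbove_right_injective e)
        simp [Function.update_of_ne h, Function.update_of_ne h2]
  simp only [yamagutiCoboundary, LinearMap.coe_mk, AddHom.coe_mk, add_apply,
    LinearMap.add_apply, sum_apply, LinearMap.sum_apply, smul_apply,
    LinearMap.smul_apply, LinearMap.uncurryMid_apply, LinearMap.comp_apply, postComp_apply,
    pairPart_apply, thetaPart_tmul, TensorProduct.lift.tmul, Fin.removeNth_apply]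
  rw [add_assoc, ← Finset.sum_add_distrib]
  congr 1
  · simp only [he, Fin.succAbove_last]
  refine Finset.sum_congr rfl fun k _ => ?_
  have := hsub k (br (x k) (y k))
  simp only [he]
  rw [this, pow_succ, mul_neg_one, neg_smul, ← smul_neg, ← smul_add]
  congr 1
  abel

end Yamaguti

/-! ### The graded Lie bracket on `C*(V, V)` -/

section Bracket

variable {K V : Type*} [Field K] [AddCommGroup V] [Module K V]

/-- The pairs of arguments of `P` in `insertPair`. -/
def pairArgs {p q N : ℕ} (h : p + q = N) (Q : Cochain K V V q) (s : Fin p)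
    (X : Fin N → V ⊗[K] V) (j : Fin p) : V ⊗[K] V :=
  if j < s then X ⟨j, by omega⟩
  else if j = s then actPair (Q fun i => X ⟨s + i, by omega⟩) (X ⟨s + q, by omega⟩)
  else X ⟨j + q, by omega⟩

theorem pairArgs_update {p q N : ℕ} (h : p + q = N) (Q : Cochain K V V q) (s : Fin p)
    (X : Fin N → V ⊗[K] V) (i : Fin N) :
    ∃ (k : Fin p) (g : V ⊗[K] V →ₗ[K] V ⊗[K] V),
      ∀ a, pairArgs h Q s (Function.update X i a) = Function.update (pairArgs h Q s X) k (g a) := by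
  have hne : ∀ (m : ℕ) (hm : m < N) (a : V ⊗[K] V), m ≠ (i : ℕ) →
      Function.update X i a ⟨m, hm⟩ = X ⟨m, hm⟩ := fun m hm a hmi =>
    Function.update_of_ne (fun e => hmi (congrArg Fin.val e)) _ _
  have heq : ∀ (m : ℕ) (hm : m < N) (a : V ⊗[K] V), m = (i : ℕ) →
      Function.update X i a ⟨m, hm⟩ = a := fun m hm a hmi => by
    subst hmi; exact Function.update_self _ _ _
  have hs := s.isLt
  rcases lt_trichotomy (i : ℕ) (s + q) with hi | hi | hi
  · by_cases his : (i : ℕ) < s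
    · refine ⟨⟨i, by omega⟩, LinearMap.id, fun a => funext fun j => ?_⟩
      have hQ : (fun k : Fin q => Function.update X i a ⟨s + k, by omega⟩)
          = fun k : Fin q => X ⟨s + k, by omega⟩ := funext fun k => hne _ _ _ (by omega)
      by_cases hj : j = ⟨i, by omega⟩
      · subst hj
        rw [Function.update_self, pairArgs, if_pos (by simpa [Fin.lt_def] using his)]
        exact heq _ _ _ rfl
      · have hj' : (j : ℕ) ≠ i := fun e => hj (Fin.ext e)
        rw [Function.update_of_ne hj]
        simp only [pairArgs, hQ]
        rw [hne _ _ _ hj', hne (s + q) _ _ (by omega)]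
        split_ifs with h1 h2
        · rfl
        · rfl
        · refine hne _ _ _ ?_
          have : (s : ℕ) < j := by
            rcases lt_trichotomy j s with h3 | h3 | h3
            · exact absurd h3 h1
            · exact absurd h3 h2
            · exact h3
          omega
    · refine ⟨s, actPair.flip (X ⟨s + q, by omega⟩) ∘ₗ
        Q.toLinearMap (fun k => X ⟨s + k, by omega⟩) ⟨(i : ℕ) - s, by omega⟩,
        fun a => funext fun j => ?_⟩
      have hQ : (fun k : Fin q => Function.update X i a ⟨s + k, by omega⟩)
          = Function.update (fun k : Fin q => X ⟨s + k, by omega⟩) ⟨(i : ℕ) - s, by omega⟩ a := by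
        funext k
        by_cases hk : k = ⟨(i : ℕ) - s, by omega⟩
        · rw [hk, Function.update_self]
          exact heq _ _ _ (by simp; omega)
        · rw [Function.update_of_ne hk]
          refine hne _ _ _ fun e => hk (Fin.ext ?_)
          simp; omega
      by_cases hj : j = s
      · subst hj
        rw [Function.update_self]
        simp only [pairArgs, hQ, lt_irrefl, if_false, if_true]
        rw [hne (j + q) _ _ (by omega)]
        rfl
      · rw [Function.update_of_ne hj]
        simp only [pairArgs, if_neg hj]
        split_ifs with h1
        · exact hne _ _ _ (by simp only [Fin.lt_def] at h1; omega)
        · refine hne _ _ _ ?_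
          have : (j : ℕ) ≠ s := fun e => hj (Fin.ext e)
          simp only [Fin.lt_def] at h1
          omega
  · refine ⟨s, actPair (Q fun k => X ⟨s + k, by omega⟩), fun a => funext fun j => ?_⟩
    have hQ : (fun k : Fin q => Function.update X i a ⟨s + k, by omega⟩)
        = fun k : Fin q => X ⟨s + k, by omega⟩ := funext fun k => hne _ _ _ (by omega)
    by_cases hj : j = s
    · subst hj
      rw [Function.update_self]
      simp only [pairArgs, hQ, lt_irrefl, if_false, if_true]
      rw [heq (j + q) _ _ hi.symm]
    · rw [Function.update_of_ne hj]
      have : (j : ℕ) ≠ s := fun e => hj (Fin.ext e)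
      simp only [pairArgs, if_neg hj]
      split_ifs with h1
      · exact hne _ _ _ (by simp only [Fin.lt_def] at h1; omega)
      · exact hne _ _ _ (by simp only [Fin.lt_def] at h1; omega)
  · refine ⟨⟨(i : ℕ) - q, by omega⟩, LinearMap.id, fun a => funext fun j => ?_⟩
    have hQ : (fun k : Fin q => Function.update X i a ⟨s + k, by omega⟩)
        = fun k : Fin q => X ⟨s + k, by omega⟩ := funext fun k => hne _ _ _ (by omega)
    by_cases hj : j = ⟨(i : ℕ) - q, by omega⟩
    · have hv : (j : ℕ) = i - q := congrArg Fin.val hj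
      rw [← hj, Function.update_self, pairArgs,
        if_neg (by simp only [Fin.lt_def]; omega), if_neg (fun e => by subst e; omega)]
      exact heq _ _ _ (by omega)
    · have hj' : (j : ℕ) ≠ i - q := fun e => hj (Fin.ext e)
      rw [Function.update_of_ne hj]
      simp only [pairArgs, hQ]
      rw [hne (s + q) _ _ (by omega), hne (j + q) _ _ (by omega)]
      split_ifs with h1 h2
      · exact hne _ _ _ (by simp only [Fin.lt_def] at h1; omega)
      · rfl
      · rfl

/-- `(X_1, …, X_{p+q}, x) ↦
P(X_1, …, X_s, Q(X_{s+1}, …, X_{s+q}, x_{s+q+1}) ⊗ y_{s+q+1}, X_{s+q+2}, …, X_{p+q}, x)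
+ P(X_1, …, X_s, x_{s+q+1} ⊗ Q(X_{s+1}, …, X_{s+q}, y_{s+q+1}), X_{s+q+2}, …, X_{p+q}, x)`
where `X_i = x_i ⊗ y_i`. -/
def insertPair {p q N : ℕ} (h : p + q = N) (P : Cochain K V V p) (Q : Cochain K V V q)
    (s : Fin p) : Cochain K V V N :=
  MultilinearMap.mk' (fun X => P (pairArgs h Q s X))
    (fun X i a b => by
      obtain ⟨k, g, hg⟩ := pairArgs_update h Q s X i
      simp only [hg, map_add, MultilinearMap.map_update_add])
    (fun X i c a => by
      obtain ⟨k, g, hg⟩ := pairArgs_update h Q s X i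
      simp only [hg, map_smul, MultilinearMap.map_update_smul])

theorem insertLast_update {p q N : ℕ} (h : p + q = N) (P : Cochain K V V p) (Q : Cochain K V V q)
    (X : Fin N → V ⊗[K] V) (i : Fin N) :
    ∃ g : V ⊗[K] V →ₗ[K] V →ₗ[K] V, ∀ a,
      P (fun j => Function.update X i a ⟨j, by omega⟩)
        ∘ₗ Q (fun j => Function.update X i a ⟨p + j, by omega⟩) = g a := by
  have hne : ∀ (m : ℕ) (hm : m < N) (a : V ⊗[K] V), m ≠ (i : ℕ) →
      Function.update X i a ⟨m, hm⟩ = X ⟨m, hm⟩ := fun m hm a hmi =>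
    Function.update_of_ne (fun e => hmi (congrArg Fin.val e)) _ _
  have heq : ∀ (m : ℕ) (hm : m < N) (a : V ⊗[K] V), m = (i : ℕ) →
      Function.update X i a ⟨m, hm⟩ = a := fun m hm a hmi => by
    subst hmi; exact Function.update_self _ _ _
  by_cases hi : (i : ℕ) < p
  · refine ⟨(LinearMap.llcomp K V V V).flip (Q fun j => X ⟨p + j, by omega⟩) ∘ₗ
      P.toLinearMap (fun j => X ⟨j, by omega⟩) ⟨i, hi⟩, fun a => ?_⟩
    have hQ : (fun k : Fin q => Function.update X i a ⟨p + k, by omega⟩)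
        = fun k : Fin q => X ⟨p + k, by omega⟩ := funext fun k => hne _ _ _ (by omega)
    have hP : (fun k : Fin p => Function.update X i a ⟨k, by omega⟩)
        = Function.update (fun k : Fin p => X ⟨k, by omega⟩) ⟨i, hi⟩ a := by
      funext k
      by_cases hk : k = ⟨i, hi⟩
      · rw [hk]
        exact (heq _ _ _ rfl).trans (by rw [Function.update_self])
      · rw [Function.update_of_ne hk]
        exact hne _ _ _ fun e => hk (Fin.ext e)
    rw [hQ, hP]
    rfl
  · refine ⟨(LinearMap.llcomp K V V V) (P fun j => X ⟨j, by omega⟩) ∘ₗ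
      Q.toLinearMap (fun j => X ⟨p + j, by omega⟩) ⟨(i : ℕ) - p, by omega⟩, fun a => ?_⟩
    have hP : (fun k : Fin p => Function.update X i a ⟨k, by omega⟩)
        = fun k : Fin p => X ⟨k, by omega⟩ := funext fun k => hne _ _ _ (by omega)
    have hQ : (fun k : Fin q => Function.update X i a ⟨p + k, by omega⟩)
        = Function.update (fun k : Fin q => X ⟨p + k, by omega⟩) ⟨(i : ℕ) - p, by omega⟩ a := by
      funext k
      by_cases hk : k = ⟨(i : ℕ) - p, by omega⟩
      · rw [hk, Function.update_self]
        exact heq _ _ _ (by simp; omega)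
      · rw [Function.update_of_ne hk]
        refine hne _ _ _ fun e => hk (Fin.ext ?_)
        simp; omega
    rw [hQ, hP]
    rfl

/-- `(X_1, …, X_{p+q}, x) ↦ P(X_1, …, X_p, Q(X_{p+1}, …, X_{p+q}, x))`. -/
def insertLast {p q N : ℕ} (h : p + q = N) (P : Cochain K V V p) (Q : Cochain K V V q) :
    Cochain K V V N :=
  MultilinearMap.mk'
    (fun X => P (fun j => X ⟨j, by omega⟩) ∘ₗ Q (fun j => X ⟨p + j, by omega⟩))
    (fun X i a b => by
      obtain ⟨g, hg⟩ := insertLast_update h P Q X i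
      simp only [hg, map_add])
    (fun X i c a => by
      obtain ⟨g, hg⟩ := insertLast_update h P Q X i
      simp only [hg, map_smul])

/-- The `(s, q)`-shuffles, as permutations of `{0, …, N-1}` that fix every `i ≥ s + q`. -/
def IsShuffle (s q : ℕ) {N : ℕ} (σ : Equiv.Perm (Fin N)) : Prop :=
  (∀ i j : Fin N, i < j → (j : ℕ) < s → σ i < σ j) ∧
  (∀ i j : Fin N, s ≤ (i : ℕ) → i < j → (j : ℕ) < s + q → σ i < σ j) ∧
  (∀ i : Fin N, s + q ≤ (i : ℕ) → σ i = i)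

instance (s q : ℕ) {N : ℕ} : DecidablePred (IsShuffle s q (N := N)) := fun σ => by
  unfold IsShuffle; infer_instance

/-- The sign of a permutation, in `K`. -/
def sgn (K : Type*) [Field K] {N : ℕ} (σ : Equiv.Perm (Fin N)) : K := ((Equiv.Perm.sign σ : ℤ) : K)

/-- The composition `P ∘ Q`; the index `s` is `k - 1` for `1 ≤ k ≤ p`. -/
def circ {p q N : ℕ} (h : p + q = N) (P : Cochain K V V p) (Q : Cochain K V V q) :
    Cochain K V V N :=
  (∑ s : Fin p, (-1 : K) ^ ((s : ℕ) * q) •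
    ∑ σ ∈ Finset.univ.filter (fun σ : Equiv.Perm (Fin N) => IsShuffle s q σ),
      sgn K σ • (insertPair h P Q s).domDomCongr σ)
  + ∑ σ ∈ Finset.univ.filter (fun σ : Equiv.Perm (Fin N) => IsShuffle p q σ),
      ((-1 : K) ^ (p * q) * sgn K σ) • (insertLast h P Q).domDomCongr σ

/-- The graded Lie bracket `[P, Q] = P ∘ Q - (-1)^{pq} Q ∘ P`. -/
def bracket {p q N : ℕ} (h : p + q = N) (P : Cochain K V V p) (Q : Cochain K V V q) :
    Cochain K V V N :=
  circ h P Q - (-1 : K) ^ (p * q) • circ (by omega) Q P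

theorem insertPair_add {p q N : ℕ} (h : p + q = N) (P : Cochain K V V p)
    (Q Q' : Cochain K V V q) (s : Fin p) :
    insertPair h P (Q + Q') s = insertPair h P Q s + insertPair h P Q' s := by
  refine MultilinearMap.ext fun X => ?_
  have key : ∀ R : Cochain K V V q, pairArgs h R s X = Function.update (pairArgs h 0 s X) s
      (actPair (R fun i => X ⟨s + i, by omega⟩) (X ⟨s + q, by omega⟩)) := by
    intro R
    funext j
    by_cases hj : j = s
    · subst hj; simp [pairArgs]
    · simp [pairArgs, hj]
  change P _ = P _ + P _
  rw [key (Q + Q'), key Q, key Q', add_apply, map_add, LinearMap.add_apply,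
    MultilinearMap.map_update_add]

theorem insertPair_smul {p q N : ℕ} (h : p + q = N) (P : Cochain K V V p) (c : K)
    (Q : Cochain K V V q) (s : Fin p) :
    insertPair h P (c • Q) s = c • insertPair h P Q s := by
  refine MultilinearMap.ext fun X => ?_
  have key : ∀ R : Cochain K V V q, pairArgs h R s X = Function.update (pairArgs h 0 s X) s
      (actPair (R fun i => X ⟨s + i, by omega⟩) (X ⟨s + q, by omega⟩)) := by
    intro R
    funext j
    by_cases hj : j = s
    · subst hj; simp [pairArgs]
    · simp [pairArgs, hj]
  change P _ = c • P _
  rw [key (c • Q), key Q, smul_apply, map_smul, LinearMap.smul_apply,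
    MultilinearMap.map_update_smul]

theorem circ_add_right {p q N : ℕ} (h : p + q = N) (P : Cochain K V V p)
    (Q Q' : Cochain K V V q) : circ h P (Q + Q') = circ h P Q + circ h P Q' := by
  have hl : insertLast h P (Q + Q') = insertLast h P Q + insertLast h P Q' :=
    MultilinearMap.ext fun X => LinearMap.ext fun z =>
      map_add (P fun j => X ⟨j, by omega⟩) _ _
  have hd : ∀ (F G : Cochain K V V N) (σ : Equiv.Perm (Fin N)),
    (F + G).domDomCongr σ = F.domDomCongr σ + G.domDomCongr σ := fun _ _ _ => rfl
  simp only [circ, insertPair_add, hl, hd, smul_add, Finset.sum_add_distrib]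
  exact add_add_add_comm _ _ _ _

theorem circ_smul_right {p q N : ℕ} (h : p + q = N) (P : Cochain K V V p) (c : K)
    (Q : Cochain K V V q) : circ h P (c • Q) = c • circ h P Q := by
  have hl : insertLast h P (c • Q) = c • insertLast h P Q :=
    MultilinearMap.ext fun X => LinearMap.ext fun z =>
      map_smul (P fun j => X ⟨j, by omega⟩) _ _
  have hd : ∀ (F : Cochain K V V N) (σ : Equiv.Perm (Fin N)),
    (c • F).domDomCongr σ = c • F.domDomCongr σ := fun _ _ => rfl
  simp only [circ, insertPair_smul, hl, hd, smul_add, Finset.smul_sum]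
  simp only [smul_comm _ c]

theorem circ_add_left {p q N : ℕ} (h : p + q = N) (P P' : Cochain K V V p)
    (Q : Cochain K V V q) : circ h (P + P') Q = circ h P Q + circ h P' Q := by
  have hp : ∀ s, insertPair h (P + P') Q s = insertPair h P Q s + insertPair h P' Q s :=
    fun _ => rfl
  have hl : insertLast h (P + P') Q = insertLast h P Q + insertLast h P' Q := rfl
  have hd : ∀ (F G : Cochain K V V N) (σ : Equiv.Perm (Fin N)),
    (F + G).domDomCongr σ = F.domDomCongr σ + G.domDomCongr σ := fun _ _ _ => rfl
  simp only [circ, hp, hl, hd, smul_add, Finset.sum_add_distrib]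
  exact add_add_add_comm _ _ _ _

theorem circ_smul_left {p q N : ℕ} (h : p + q = N) (c : K) (P : Cochain K V V p)
    (Q : Cochain K V V q) : circ h (c • P) Q = c • circ h P Q := by
  have hp : ∀ s, insertPair h (c • P) Q s = c • insertPair h P Q s := fun _ => rfl
  have hl : insertLast h (c • P) Q = c • insertLast h P Q := rfl
  have hd : ∀ (F : Cochain K V V N) (σ : Equiv.Perm (Fin N)),
    (c • F).domDomCongr σ = c • F.domDomCongr σ := fun _ _ => rfl
  simp only [circ, hp, hl, hd, smul_add, Finset.smul_sum]
  simp only [smul_comm _ c]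

theorem bracket_add_right {p q N : ℕ} (h : p + q = N) (P : Cochain K V V p)
    (Q Q' : Cochain K V V q) : bracket h P (Q + Q') = bracket h P Q + bracket h P Q' := by
  simp only [bracket, circ_add_right, circ_add_left, smul_add]
  abel

theorem bracket_smul_right {p q N : ℕ} (h : p + q = N) (P : Cochain K V V p) (c : K)
    (Q : Cochain K V V q) : bracket h P (c • Q) = c • bracket h P Q := by
  simp only [bracket, circ_smul_right, circ_smul_left, smul_sub]
  rw [smul_comm c]

end Bracket

/-! ### The brackets `l₃`, `l₄` on `C*(M, L)` and the twisted differential -/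

section Differential

variable {K L M : Type*} [Field K] [AddCommGroup L] [Module K L] [AddCommGroup M] [Module K M]

/-- The trilinear map `π + θ` on `L ⊕ M`:
`(x + u, y + v, z + w) ↦ [x, y, z] + θ(y, z) u - θ(x, z) v + D(x, y) w`. -/
def semidirect (br : L →ₗ[K] L →ₗ[K] L →ₗ[K] L) (θ : L →ₗ[K] L →ₗ[K] M →ₗ[K] M) :
    L × M →ₗ[K] L × M →ₗ[K] L × M →ₗ[K] L × M :=
  mk₃ (fun a b c => (br a.1 b.1 c.1, θ b.1 c.1 a.2 - θ a.1 c.1 b.2 + dOp θ a.1 b.1 c.2))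
    (by intros; ext <;> simp; abel) (by intros; ext <;> simp [smul_add, smul_sub])
    (by intros; ext <;> simp; abel) (by intros; ext <;> simp [smul_add, smul_sub])
    (by intros; ext <;> simp; abel) (by intros; ext <;> simp [smul_add, smul_sub])

/-- `H` as a trilinear map on `L ⊕ M`: `(x + u, y + v, z + w) ↦ H(x, y, z)`. -/
def cocycleExt (H : L →ₗ[K] L →ₗ[K] L →ₗ[K] M) :
    L × M →ₗ[K] L × M →ₗ[K] L × M →ₗ[K] L × M :=
  mk₃ (fun a b c => (0, H a.1 b.1 c.1))
    (by intros; ext <;> simp) (by intros; ext <;> simp)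
    (by intros; ext <;> simp) (by intros; ext <;> simp)
    (by intros; ext <;> simp) (by intros; ext <;> simp)

/-- A trilinear map as a cochain of degree `1`. -/
def trilinearCochain {V : Type*} [AddCommGroup V] [Module K V]
    (t : V →ₗ[K] V →ₗ[K] V →ₗ[K] V) : Cochain K V V 1 :=
  MultilinearMap.ofSubsingleton K (V ⊗[K] V) (V →ₗ[K] V) (0 : Fin 1) (TensorProduct.lift t)

/-- A linear map as a cochain of degree `0`. -/
def linearCochain {V W : Type*} [AddCommGroup V] [Module K V] [AddCommGroup W] [Module K W]
    (T : V →ₗ[K] W) : Cochain K V W 0 :=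
  MultilinearMap.constOfIsEmpty K (fun _ : Fin 0 => V ⊗[K] V) T

/-- The inclusion of `Cⁿ(M, L)` in `Cⁿ(L ⊕ M, L ⊕ M)`: apply the projection `L ⊕ M → M` to all
arguments, then `f`, then the inclusion `L → L ⊕ M`. -/
def extendCochain {n : ℕ} : Cochain K M L n →ₗ[K] Cochain K (L × M) (L × M) n where
  toFun f := ((LinearMap.inl K L M).compRight K ∘ₗ
      LinearMap.lcomp K L (LinearMap.snd K L M)).compMultilinearMap
    (f.compLinearMap fun _ => TensorProduct.map (LinearMap.snd K L M) (LinearMap.snd K L M))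
  map_add' _ _ := by ext <;> simp
  map_smul' _ _ := by ext <;> simp

/-- The component `M × ⋯ × M → L` of a cochain on `L ⊕ M`. -/
def restrictCochain {n : ℕ} : Cochain K (L × M) (L × M) n →ₗ[K] Cochain K M L n where
  toFun F := ((LinearMap.fst K L M).compRight K ∘ₗ
      LinearMap.lcomp K (L × M) (LinearMap.inr K L M)).compMultilinearMap
    (F.compLinearMap fun _ => TensorProduct.map (LinearMap.inr K L M) (LinearMap.inr K L M))
  map_add' _ _ := by ext; simp
  map_smul' _ _ := by ext; simp

/-- `l₃(P, Q, R) = [[[π + θ, P], Q], R]`. -/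
def l₃ (br : L →ₗ[K] L →ₗ[K] L →ₗ[K] L) (θ : L →ₗ[K] L →ₗ[K] M →ₗ[K] M) {p q r N : ℕ}
    (h : 1 + p + q + r = N) (P : Cochain K (L × M) (L × M) p) (Q : Cochain K (L × M) (L × M) q)
    (R : Cochain K (L × M) (L × M) r) : Cochain K (L × M) (L × M) N :=
  bracket h (bracket rfl (bracket rfl (trilinearCochain (semidirect br θ)) P) Q) R

/-- `l₄(P, Q, R, S) = [[[[H, P], Q], R], S]`. -/
def l₄ (H : L →ₗ[K] L →ₗ[K] L →ₗ[K] M) {p q r s N : ℕ} (h : 1 + p + q + r + s = N)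
    (P : Cochain K (L × M) (L × M) p) (Q : Cochain K (L × M) (L × M) q)
    (R : Cochain K (L × M) (L × M) r) (S : Cochain K (L × M) (L × M) s) :
    Cochain K (L × M) (L × M) N :=
  bracket h (bracket rfl (bracket rfl (bracket rfl (trilinearCochain (cocycleExt H)) P) Q) R) S

/-- `l₁ᵀ(F) = ∑ₙ (1/n!) l_{n+1}(T, …, T, F) = (1/2) l₃(T, T, F) + (1/6) l₄(T, T, T, F)`: the only
nonzero brackets of the `L∞`-algebra are `l₃` and `l₄`. -/
def l₁Twisted (br : L →ₗ[K] L →ₗ[K] L →ₗ[K] L) (θ : L →ₗ[K] L →ₗ[K] M →ₗ[K] M)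
    (H : L →ₗ[K] L →ₗ[K] L →ₗ[K] M) (T : M →ₗ[K] L) (n : ℕ) :
    Cochain K (L × M) (L × M) n →ₗ[K] Cochain K (L × M) (L × M) (n + 1) where
  toFun F :=
    (1 / 2 : K) • l₃ br θ (by omega)
      (extendCochain (linearCochain T)) (extendCochain (linearCochain T)) F
    + (1 / 6 : K) • l₄ H (by omega) (extendCochain (linearCochain T))
      (extendCochain (linearCochain T)) (extendCochain (linearCochain T)) F
  map_add' F G := by
    simp only [l₃, l₄, bracket_add_right, smul_add]
    abel
  map_smul' c F := by
    simp only [l₃, l₄, bracket_smul_right, smul_add, RingHom.id_apply]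
    rw [smul_comm c, smul_comm c]

/-- The differential `d_T = l₁ᵀ` on `C*(M, L)`. -/
def twistedDifferential (br : L →ₗ[K] L →ₗ[K] L →ₗ[K] L) (θ : L →ₗ[K] L →ₗ[K] M →ₗ[K] M)
    (H : L →ₗ[K] L →ₗ[K] L →ₗ[K] M) (T : M →ₗ[K] L) (n : ℕ) :
    Cochain K M L n →ₗ[K] Cochain K M L (n + 1) :=
  restrictCochain ∘ₗ l₁Twisted br θ H T n ∘ₗ extendCochain

/-- The coboundary `Λ_T` of `(M, [·,·,·]_T)` with coefficients in `(L, θ_T)`. -/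
def lambdaT (br : L →ₗ[K] L →ₗ[K] L →ₗ[K] L) (θ : L →ₗ[K] L →ₗ[K] M →ₗ[K] M)
    (H : L →ₗ[K] L →ₗ[K] L →ₗ[K] M) (T : M →ₗ[K] L) (n : ℕ) :
    Cochain K M L n →ₗ[K] Cochain K M L (n + 1) :=
  yamagutiCoboundary (inducedBracket θ H T) (inducedRep br θ H T) n

end Differential

/-! ### Cohomology -/

section Subquotient

variable {K E : Type*} [Field K] [AddCommGroup E] [Module K E]

/-- The quotient `Z / (B ∩ Z)`. -/
def Subquotient (Z B : Submodule K E) : Type _ := Z ⧸ B.submoduleOf Z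

instance (Z B : Submodule K E) : AddCommGroup (Subquotient Z B) :=
  inferInstanceAs (AddCommGroup (Z ⧸ B.submoduleOf Z))

instance (Z B : Submodule K E) : Module K (Subquotient Z B) :=
  inferInstanceAs (Module K (Z ⧸ B.submoduleOf Z))

/-- The class of an element of `Z` in `Z / (B ∩ Z)`. -/
def Subquotient.mk (Z B : Submodule K E) : Z →ₗ[K] Subquotient Z B := (B.submoduleOf Z).mkQ

end Subquotient

section Cohomology

variable {K V W : Type*} [Field K] [AddCommGroup V] [Module K V] [AddCommGroup W] [Module K W]

variable (K V W) in
/-- The Yamaguti cochains: `φ(…, x, x, y) = 0` and the cyclic sum of `φ(…, x, y, z)` over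
`x, y, z` vanishes. In degree `0` (one argument) there is no condition. -/
def yamagutiCochains (n : ℕ) : Submodule K (Cochain K V W n) where
  carrier := {φ | ∀ i : Fin n, (i : ℕ) + 1 = n → ∀ X : Fin n → V ⊗[K] V,
    (∀ x y : V, φ (Function.update X i (x ⊗ₜ x)) y = 0) ∧
    (∀ x y z : V, φ (Function.update X i (x ⊗ₜ y)) z + φ (Function.update X i (y ⊗ₜ z)) x
      + φ (Function.update X i (z ⊗ₜ x)) y = 0)}
  add_mem' {φ ψ} hφ hψ i hi X := by
    refine ⟨fun x y => ?_, fun x y z => ?_⟩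
    · simp [(hφ i hi X).1 x y, (hψ i hi X).1 x y]
    · have h₁ := (hφ i hi X).2 x y z
      have h₂ := (hψ i hi X).2 x y z
      simp only [add_apply, LinearMap.add_apply]
      rw [add_add_add_comm (φ _ z), add_add_add_comm, h₁, h₂, add_zero]
  zero_mem' := by intro i _ X; simp
  smul_mem' c φ hφ i hi X := by
    refine ⟨fun x y => ?_, fun x y z => ?_⟩
    · simp [(hφ i hi X).1 x y]
    · have h₁ := (hφ i hi X).2 x y z
      simp only [smul_apply, LinearMap.smul_apply]
      rw [← smul_add, ← smul_add, h₁, smul_zero]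

variable (K V W) in
/-- The Yamaguti cochains that are skew-symmetric in each of the pairs of arguments, that is, maps
`(∧²V)^{⊗n} ⊗ V → W` that satisfy the conditions of `yamagutiCochains`. -/
def alternatingCochains (n : ℕ) : Submodule K (Cochain K V W n) where
  carrier := {φ | φ ∈ yamagutiCochains K V W n ∧
    ∀ (i : Fin n) (X : Fin n → V ⊗[K] V) (x y : V), φ (Function.update X i (x ⊗ₜ x)) y = 0}
  add_mem' {φ ψ} hφ hψ :=
    ⟨add_mem hφ.1 hψ.1, fun i X x y => by simp [hφ.2 i X x y, hψ.2 i X x y]⟩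
  zero_mem' := ⟨zero_mem _, fun i X x y => by simp⟩
  smul_mem' c φ hφ := ⟨Submodule.smul_mem _ c hφ.1, fun i X x y => by simp [hφ.2 i X x y]⟩

/-- The cocycles of degree `n` in the spaces of cochains `C`. -/
def cocycles (C : ∀ n, Submodule K (Cochain K V W n))
    (d : ∀ n, Cochain K V W n →ₗ[K] Cochain K V W (n + 1)) (n : ℕ) :
    Submodule K (Cochain K V W n) :=
  C n ⊓ LinearMap.ker (d n)

/-- The coboundaries `d(C^{n-1})` of degree `n`; there are none but `0` in degree `0`. -/
def coboundaries (C : ∀ n, Submodule K (Cochain K V W n))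
    (d : ∀ n, Cochain K V W n →ₗ[K] Cochain K V W (n + 1)) :
    ∀ n, Submodule K (Cochain K V W n)
  | 0 => ⊥
  | n + 1 => (C n).map (d n)

/-- The cohomology in degree `n`: cocycles modulo coboundaries. -/
abbrev Cohomology (C : ∀ n, Submodule K (Cochain K V W n))
    (d : ∀ n, Cochain K V W n →ₗ[K] Cochain K V W (n + 1)) (n : ℕ) :=
  Subquotient (cocycles C d n) (coboundaries C d n)

/-- The cohomology class of a cocycle. -/
def cohomologyClass (C : ∀ n, Submodule K (Cochain K V W n))
    (d : ∀ n, Cochain K V W n →ₗ[K] Cochain K V W (n + 1)) (n : ℕ) :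
    cocycles C d n →ₗ[K] Cohomology C d n :=
  Subquotient.mk (cocycles C d n) (coboundaries C d n)

end Cohomology

end LTS

namespace LTS

/-! ### The graph of `T` as a subsystem of the twisted semidirect product -/

section Induced

variable {K L M : Type*} [Field K] [AddCommGroup L] [Module K L] [AddCommGroup M] [Module K M]
  {br : L →ₗ[K] L →ₗ[K] L →ₗ[K] L} {θ : L →ₗ[K] L →ₗ[K] M →ₗ[K] M}
  {H : L →ₗ[K] L →ₗ[K] L →ₗ[K] M} {T : M →ₗ[K] L}

/-! Two pictures on `L ⊕ M` carry the proof.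

For the induced structures, the cocycle `H` makes `L ⊕ M` a Lie triple system, `twistedSemidirect`,
and the Reynolds condition says exactly that the graph `{Tu + u}` is closed under its bracket.
Transported to `M`, that bracket is `[·,·,·]_T` (`twistedSemidirect_graphMap`). Projecting along the
graph identifies the quotient of `L ⊕ M` by the graph with `L`, and the bracket of one arbitrary
element with two graph elements then becomes `θ_T` (`alongGraph_twistedSemidirect`). The axioms for
`[·,·,·]_T` and `θ_T` are therefore those of `L ⊕ M`, restricted to the graph or read modulo it.

For the differential, `T` has degree 0, so bracketing a trilinear map with `T` gives another
trilinear map, `adLinear`. Hence `l₁ᵀ = [μ, ·]` for the single trilinear map `μ = (1/2) ad_T² (π +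
θ) + (1/6) ad_T³ H`. Since `T`, viewed as an endomorphism of `L ⊕ M`, has square zero, each
surviving term of `μ` uses distinct slots, and each occurs in 2! or 3! orders, which cancels the
coefficients. The result is the semidirect product with the roles exchanged, in which `M` with
`[·,·,·]_T` acts on `L` by `θ_T` (`adLinear_semidirect_add_cocycleExt`).

It remains to expand `[μ, f]`. One of the two factors always has degree 1, so every shuffle that
occurs moves a single pair past the others, and the sums over shuffles become sums over the position
`k` of that pair. The terms are then those of the Yamaguti coboundary, one by one
(`bracket_moduleExtension_extendCochain`). The two operators being equal, the cohomological
statement is immediate. -/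

theorem IsLieTripleSystem.swap (h : IsLieTripleSystem br) (x y z : L) :
    br y x z = - br x y z := by
  have := h.skew (x + y) z
  simp only [map_add, LinearMap.add_apply, h.skew, zero_add, add_zero] at this
  exact eq_neg_of_add_eq_zero_left this

theorem IsThreeCocycle.swap (h : IsThreeCocycle br θ H) (x y z : L) :
    H y x z = - H x y z := by
  have := h.skew (x + y) z
  simp only [map_add, LinearMap.add_apply, h.skew, zero_add, add_zero] at this
  exact eq_neg_of_add_eq_zero_left this

/-- The semidirect product of `(L, br)` and `(M, θ)` twisted by the cocycle `H`. -/
def twistedSemidirect (br : L →ₗ[K] L →ₗ[K] L →ₗ[K] L) (θ : L →ₗ[K] L →ₗ[K] M →ₗ[K] M)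
    (H : L →ₗ[K] L →ₗ[K] L →ₗ[K] M) : L × M →ₗ[K] L × M →ₗ[K] L × M →ₗ[K] L × M :=
  semidirect br θ + cocycleExt H

theorem twistedSemidirect_apply (a b c : L × M) :
    twistedSemidirect br θ H a b c = (br a.1 b.1 c.1,
      θ b.1 c.1 a.2 - θ a.1 c.1 b.2 + dOp θ a.1 b.1 c.2 + H a.1 b.1 c.1) := by
  simp [twistedSemidirect, semidirect, cocycleExt]

theorem isLieTripleSystem_twistedSemidirect (hbr : IsLieTripleSystem br)
    (hθ : IsRepresentation br θ) (hH : IsThreeCocycle br θ H) :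
    IsLieTripleSystem (twistedSemidirect br θ H) where
  skew a b := by
    simp [twistedSemidirect_apply, hbr.skew, hH.skew]
  cyclic a b c := by
    have h := hH.cyclic a.1 b.1 c.1
    simp only [twistedSemidirect_apply, Prod.mk_add_mk, hbr.cyclic, dOp_apply, Prod.mk_eq_zero,
      true_and]
    linear_combination (norm := abel) h
  derivation := by
    rintro ⟨x, u⟩ ⟨y, v⟩ ⟨z, w⟩ ⟨t, p⟩ ⟨e, q⟩
    simp only [twistedSemidirect_apply, Prod.mk_add_mk, Prod.mk.injEq]
    refine ⟨hbr.derivation x y z t e, ?_⟩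
    have hd := hbr.derivation x y z t e
    have hu := hθ.rep₁ y z t e u
    have hv := hθ.rep₁ x z t e v
    have hw := hθ.rep₂ x y t e w
    have hp := hθ.rep₂ x y z e p
    have hq := hθ.rep₂ x y z t q
    have hq' := hθ.rep₂ x y t z q
    have hc := hH.cocycle x y z t e
    simp only [map_add, map_sub, dOp_apply] at *
    -- The `M`-component is a sum of parts linear in `u`, `v`, `w`, `p`, `q` and a part in `H`
    -- alone. The outer `D(x, y)` meets a `D(z, t)` in the `q` part, hence two instances of `rep₂`
    -- there.
    linear_combination (norm := abel) hc - hu + hv - hw + hp + hq - hq'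

/-- The embedding `u ↦ T u + u` of `M` in `L ⊕ M`. -/
def graphMap (T : M →ₗ[K] L) : M →ₗ[K] L × M := T.prod LinearMap.id

theorem graphMap_apply (u : M) : graphMap T u = (T u, u) := rfl

/-- The projection of `L ⊕ M` to `L` along the graph of `T`. -/
def alongGraph (T : M →ₗ[K] L) : L × M →ₗ[K] L := LinearMap.fst K L M - T ∘ₗ LinearMap.snd K L M

theorem alongGraph_apply (a : L × M) : alongGraph T a = a.1 - T a.2 := rfl

/-- The `M`-component holds by definition of the induced bracket; the `L`-component is the Reynolds
identity. This is where `T` being a Reynolds operator enters the induced structures. -/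
theorem twistedSemidirect_graphMap (hT : IsGeneralizedReynolds br θ H T) (u v w : M) :
    twistedSemidirect br θ H (graphMap T u) (graphMap T v) (graphMap T w)
      = graphMap T (inducedBracket θ H T u v w) := by
  rw [twistedSemidirect_apply]
  simp only [graphMap_apply, inducedBracket, mk₃_apply, Prod.mk.injEq, and_true]
  rw [hT]
  congr 2
  abel

theorem alongGraph_graphMap (u : M) : alongGraph T (graphMap T u) = 0 := by
  simp [alongGraph, graphMap]

theorem alongGraph_inl (x : L) : alongGraph T (x, 0) = x := by
  simp [alongGraph]

theorem eq_inl_add_graphMap (a : L × M) : a = (alongGraph T a, 0) + graphMap T a.2 := by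
  ext <;> simp [alongGraph, graphMap]

/-- Only the class of `a` modulo the graph matters: a graph component of `a` contributes a bracket
inside the graph, which the projection kills. On the remaining vector of `L` the two sides agree by
expansion. -/
theorem alongGraph_twistedSemidirect (hT : IsGeneralizedReynolds br θ H T) (a : L × M) (v w : M) :
    alongGraph T (twistedSemidirect br θ H a (graphMap T v) (graphMap T w))
      = inducedRep br θ H T v w (alongGraph T a) := by
  conv_lhs => rw [eq_inl_add_graphMap (T := T) a]
  rw [map_add, LinearMap.add_apply, LinearMap.add_apply, map_add,
    twistedSemidirect_graphMap hT, alongGraph_graphMap, add_zero, twistedSemidirect_apply]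
  simp only [alongGraph_apply, graphMap_apply, inducedRep, mk₃_apply, map_zero]
  congr 2
  abel

/-- Cyclicity and skew-symmetry give `[v, w, a] = [a, w, v] - [a, v, w]`, the same expression by
which `D` is built from `θ`. -/
theorem alongGraph_twistedSemidirect_left (hbr : IsLieTripleSystem br)
    (hθ : IsRepresentation br θ) (hH : IsThreeCocycle br θ H)
    (hT : IsGeneralizedReynolds br θ H T) (a : L × M) (v w : M) :
    alongGraph T (twistedSemidirect br θ H (graphMap T v) (graphMap T w) a)
      = dOp (inducedRep br θ H T) v w (alongGraph T a) := by
  have hS := isLieTripleSystem_twistedSemidirect hbr hθ hH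
  have h : twistedSemidirect br θ H (graphMap T v) (graphMap T w) a
      = twistedSemidirect br θ H a (graphMap T w) (graphMap T v)
        - twistedSemidirect br θ H a (graphMap T v) (graphMap T w) := by
    have h₁ := hS.cyclic (graphMap T v) (graphMap T w) a
    rw [hS.swap a (graphMap T w)] at h₁
    linear_combination (norm := abel) h₁
  rw [h, map_sub, alongGraph_twistedSemidirect hT, alongGraph_twistedSemidirect hT, dOp_apply]

theorem graphMap_injective : Function.Injective (graphMap T) :=
  fun _ _ h => congrArg Prod.snd h

theorem isLieTripleSystem_inducedBracket (hbr : IsLieTripleSystem br)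
    (hθ : IsRepresentation br θ) (hH : IsThreeCocycle br θ H)
    (hT : IsGeneralizedReynolds br θ H T) : IsLieTripleSystem (inducedBracket θ H T) where
  skew u v := graphMap_injective (T := T) <| by
    rw [← twistedSemidirect_graphMap hT, map_zero]
    exact (isLieTripleSystem_twistedSemidirect hbr hθ hH).skew _ _
  cyclic u v w := graphMap_injective (T := T) <| by
    simp only [map_add, ← twistedSemidirect_graphMap hT, map_zero]
    exact (isLieTripleSystem_twistedSemidirect hbr hθ hH).cyclic _ _ _
  derivation u v w p q := graphMap_injective (T := T) <| by
    simp only [map_add, ← twistedSemidirect_graphMap hT]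
    exact (isLieTripleSystem_twistedSemidirect hbr hθ hH).derivation _ _ _ _ _

/-- Both axioms are the derivation identity of `L ⊕ M` with one argument arbitrary and the others in
the graph, projected along the graph. -/
theorem isRepresentation_inducedRep (hbr : IsLieTripleSystem br)
    (hθ : IsRepresentation br θ) (hH : IsThreeCocycle br θ H)
    (hT : IsGeneralizedReynolds br θ H T) :
    IsRepresentation (inducedBracket θ H T) (inducedRep br θ H T) where
  rep₁ x y z t a := by
    have hS := isLieTripleSystem_twistedSemidirect hbr hθ hH
    -- Writing the vector of `L` as a projection lets every operator be absorbed into a bracket of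
    -- `L ⊕ M` under one `alongGraph`.
    rw [← alongGraph_inl (T := T) a]
    simp only [← alongGraph_twistedSemidirect hT, ← alongGraph_twistedSemidirect_left hbr hθ hH hT,
      ← twistedSemidirect_graphMap hT]
    simp only [← map_sub, ← map_add]
    convert map_zero (alongGraph T)
    -- The derivation is `[a, x, ·]`, applied to `[y, z, t]`; the swap brings `[y, [a, x, z], t]` to
    -- the form `-[[a, x, z], y, t]`.
    rw [hS.derivation, hS.swap (twistedSemidirect br θ H (a, 0) (graphMap T x) (graphMap T z))]
    abel
  rep₂ x y z t a := by
    have hS := isLieTripleSystem_twistedSemidirect hbr hθ hH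
    rw [← alongGraph_inl (T := T) a]
    simp only [← alongGraph_twistedSemidirect hT, ← alongGraph_twistedSemidirect_left hbr hθ hH hT,
      ← twistedSemidirect_graphMap hT]
    simp only [← map_sub, ← map_add]
    convert map_zero (alongGraph T)
    rw [hS.derivation (graphMap T x) (graphMap T y) (a, 0)]
    abel

end Induced

/-! ### Shuffles that move a single index -/

section Shuffles

variable {n : ℕ}

/-- The permutation that sends `s` to `k` and is increasing on the complement of `s`. -/
def movePerm (s k : Fin (n + 1)) : Equiv.Perm (Fin (n + 1)) := s.cycleRange.trans k.cycleRange.symm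

@[simp] theorem movePerm_self (s k : Fin (n + 1)) : movePerm s k s = k := by
  simp [movePerm]

@[simp] theorem movePerm_succAbove (s k : Fin (n + 1)) (i : Fin n) :
    movePerm s k (s.succAbove i) = k.succAbove i := by
  simp [movePerm]

/-- The permutation is a cycle on the first `s + 1` indices followed by the inverse of one on the
first `k + 1`, of signs `(-1)^s` and `(-1)^k`. -/
theorem sgn_movePerm (K : Type*) [Field K] (s k : Fin (n + 1)) :
    sgn K (movePerm s k) = (-1) ^ ((s : ℕ) + k) := by
  simp [sgn, movePerm, Equiv.Perm.sign_trans, pow_add, mul_comm]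

/-- A strictly increasing map from `Fin n` is determined by its range, here the complement of `σ s`.
So the image of `s` is the only freedom left. -/
theorem eq_movePerm {s : Fin (n + 1)} {σ : Equiv.Perm (Fin (n + 1))}
    (h : StrictMono fun i => σ (s.succAbove i)) : σ = movePerm s (σ s) := by
  have key : (fun i => σ (s.succAbove i)) = (σ s).succAbove := by
    refine (Fin.strictMono_succAbove (σ s)).range_inj h |>.mp ?_ |>.symm
    rw [Fin.range_succAbove]
    ext j
    constructor
    · intro hj
      obtain ⟨i, hi⟩ := Fin.exists_succAbove_eq (x := σ.symm j) (y := s)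
        fun e => hj (by rw [← e]; simp)
      exact ⟨i, by simp [hi]⟩
    · rintro ⟨i, rfl⟩ e
      exact Fin.succAbove_ne s i (σ.injective e)
  ext1 j
  rcases Fin.eq_self_or_eq_succAbove s j with rfl | ⟨i, rfl⟩
  · simp
  · simpa using congrFun key i

theorem isShuffle_zero_left_iff {σ : Equiv.Perm (Fin (n + 1))} : IsShuffle 0 n σ ↔ σ = 1 := by
  constructor
  · rintro ⟨-, h₁, h₂⟩
    -- There are `n + 1` indices but only `n` are shuffled, so the third shuffle condition fixes the
    -- last one.
    have hl : σ (Fin.last n) = Fin.last n := h₂ _ (by simp)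
    have := eq_movePerm (s := Fin.last n) (σ := σ) fun i j hij => by
      simp only [Fin.succAbove_last]
      exact h₁ _ _ (by simp) (by simpa using hij) (by simp)
    rw [this, hl]
    ext1 j
    simp [movePerm]
  · rintro rfl
    exact ⟨fun _ _ h _ => h, fun _ _ _ h _ => h, fun _ _ => rfl⟩

theorem isShuffle_one_left_iff {σ : Equiv.Perm (Fin (n + 1))} :
    IsShuffle 1 n σ ↔ ∃ k, movePerm 0 k = σ := by
  constructor
  · rintro ⟨-, h, -⟩
    refine ⟨σ 0, (eq_movePerm fun i j hij => ?_).symm⟩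
    simp only [Fin.succAbove_zero]
    exact h _ _ (by simp) (by simpa using hij) (by simp; omega)
  · rintro ⟨k, rfl⟩
    refine ⟨fun i j hij hj => by simp only [Fin.lt_def] at hij; omega, fun i j hi hij _ => ?_,
      fun i hi => by omega⟩
    obtain ⟨i, rfl⟩ := Fin.exists_succ_eq.mpr (show i ≠ 0 by rintro rfl; simp at hi)
    obtain ⟨j, rfl⟩ := Fin.exists_succ_eq.mpr (show j ≠ 0 by rintro rfl; simp at hij)
    rw [← Fin.succAbove_zero_apply, ← Fin.succAbove_zero_apply, movePerm_succAbove,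
      movePerm_succAbove]
    exact Fin.strictMono_succAbove k (by simpa using hij)

/-- The bound `k ≤ s` reflects that indices beyond `s` are fixed, so the moved index can only come
from the first `s + 1`. -/
theorem isShuffle_one_right_iff {s : Fin (n + 1)} {σ : Equiv.Perm (Fin (n + 1))} :
    IsShuffle s 1 σ ↔ ∃ k ≤ s, movePerm s k = σ := by
  constructor
  · rintro ⟨h₁, -, h₂⟩
    -- If `σ j > s` then `σ j` is itself fixed, and injectivity forces `σ j = j ≤ s`.
    have hle : ∀ j ≤ s, σ j ≤ s := fun j hj => by
      by_contra! hlt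
      have := σ.injective (h₂ (σ j) (by simp only [Fin.lt_def] at hlt; omega))
      rw [this] at hlt
      exact absurd hlt hj.not_gt
    refine ⟨σ s, hle s le_rfl, (eq_movePerm fun i j hij => ?_).symm⟩
    have hij' := Fin.strictMono_succAbove s hij
    rcases lt_or_gt_of_ne (Fin.succAbove_ne s j) with hj | hj
    · exact h₁ _ _ hij' hj
    · have hj' := h₂ (s.succAbove j) (by simp only [Fin.lt_def] at hj; omega)
      rcases lt_or_gt_of_ne (Fin.succAbove_ne s i) with hi | hi
      · simp only [hj']
        exact (hle _ hi.le).trans_lt hj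
      · have hi' := h₂ (s.succAbove i) (by simp only [Fin.lt_def] at hi; omega)
        simpa only [hi', hj'] using hij'
  · rintro ⟨k, hk, rfl⟩
    have hmove : ∀ {i j : Fin (n + 1)}, i ≠ s → j ≠ s → i < j →
        movePerm s k i < movePerm s k j := by
      intro i j hi hj hij
      obtain ⟨i, rfl⟩ := Fin.exists_succAbove_eq hi
      obtain ⟨j, rfl⟩ := Fin.exists_succAbove_eq hj
      rw [movePerm_succAbove, movePerm_succAbove]
      exact Fin.strictMono_succAbove k ((Fin.strictMono_succAbove s).lt_iff_lt.mp hij)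
    refine ⟨fun i j hij hj => hmove (hij.trans (Fin.lt_def.mpr hj)).ne (Fin.lt_def.mpr hj).ne hij,
      fun i j hi hij hj => by simp only [Fin.lt_def] at hij; omega, fun i hi => ?_⟩
    obtain ⟨i, rfl⟩ := Fin.exists_succAbove_eq (x := i) (y := s) (by rintro rfl; omega)
    rw [movePerm_succAbove]
    have hsi : s < s.succAbove i := Fin.lt_def.mpr (by omega)
    have hs : s ≤ i.castSucc := (Fin.lt_succAbove_iff_le_castSucc _ _).mp hsi
    rw [Fin.succAbove_of_le_castSucc _ _ hs, Fin.succAbove_of_le_castSucc _ _ (hk.trans hs)]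

theorem movePerm_injective (s : Fin (n + 1)) : Function.Injective (movePerm s) := fun k l h => by
  simpa using congrArg (fun σ => σ s) h

theorem sum_isShuffle_one_left {E : Type*} [AddCommMonoid E]
    (g : Equiv.Perm (Fin (n + 1)) → E) :
    ∑ σ ∈ Finset.univ.filter (fun σ : Equiv.Perm (Fin (n + 1)) => IsShuffle 1 n σ), g σ
      = ∑ k, g (movePerm 0 k) := by
  rw [← Finset.sum_image (f := g) (g := movePerm 0) fun _ _ _ _ h => movePerm_injective 0 h]
  congr 1
  ext σ
  simp [isShuffle_one_left_iff]

theorem sum_isShuffle_one_right {E : Type*} [AddCommMonoid E] (s : Fin (n + 1))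
    (g : Equiv.Perm (Fin (n + 1)) → E) :
    ∑ σ ∈ Finset.univ.filter (fun σ : Equiv.Perm (Fin (n + 1)) => IsShuffle s 1 σ), g σ
      = ∑ k ∈ Finset.Iic s, g (movePerm s k) := by
  rw [← Finset.sum_image (f := g) (g := movePerm s) fun _ _ _ _ h => movePerm_injective s h]
  congr 1
  ext σ
  simp [isShuffle_one_right_iff]

end Shuffles

/-! ### Compositions with a degree 1 cochain -/

section Circ

variable {K V : Type*} [Field K] [AddCommGroup V] [Module K V]

/-- With the outer factor of degree 1 there is one pair to insert into, and only the identity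
shuffle does so. The other sum runs over the choice of the outer pair `X k`, with sign `(-1)^{1·n}`
times that of the shuffle. -/
theorem circ_trilinearCochain_left {n : ℕ} (h : 1 + n = n + 1) (t : V →ₗ[K] V →ₗ[K] V →ₗ[K] V)
    (F : Cochain K V V n) (X : Fin (n + 1) → V ⊗[K] V) (z : V) :
    circ h (trilinearCochain t) F X z
      = TensorProduct.lift t (actPair (F fun i => X i.castSucc) (X (Fin.last n))) z
        + ∑ k : Fin (n + 1), (-1 : K) ^ (n + (k : ℕ)) •
            TensorProduct.lift t (X k) (F (fun i => X (k.succAbove i)) z) := by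
  have hf : Finset.univ.filter (fun σ : Equiv.Perm (Fin (n + 1)) => IsShuffle 0 n σ) = {1} := by
    ext σ
    simp [isShuffle_zero_left_iff]
  simp only [circ, Finset.univ_unique, Fin.default_eq_zero, Fin.isValue, Finset.sum_singleton,
    Fin.val_zero, zero_mul, pow_zero, one_smul, hf, sum_isShuffle_one_left, sgn_movePerm, zero_add,
    one_mul, ← pow_add, add_apply, LinearMap.add_apply, sum_apply, LinearMap.sum_apply, smul_apply,
    LinearMap.smul_apply]
  congr 1
  · have : sgn K (1 : Equiv.Perm (Fin (n + 1))) = 1 := by simp [sgn]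
    rw [this, one_smul]
    change TensorProduct.lift t (pairArgs h F 0 (fun i => X i) 0) z = _
    simp only [pairArgs, lt_irrefl, if_false, if_true, Fin.val_zero, zero_add]
    rfl
  · refine Finset.sum_congr rfl fun k _ => ?_
    congr 1
    change TensorProduct.lift t (X (movePerm 0 k 0))
      (F (fun i => X (movePerm 0 k ⟨1 + i, by omega⟩)) z) = _
    rw [movePerm_self]
    congr 3
    funext i
    rw [← movePerm_succAbove 0 k i]
    congr 2
    ext
    simp [add_comm]

/-- The shuffles choose the pair `X k` fed to `t`; it acts on a later pair or on the last argument.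
The sum over insertion slots is exchanged with the sum over `k`. -/
theorem circ_trilinearCochain_right {n : ℕ} (h : n + 1 = n + 1)
    (t : V →ₗ[K] V →ₗ[K] V →ₗ[K] V) (F : Cochain K V V n) (X : Fin (n + 1) → V ⊗[K] V) (z : V) :
    circ h F (trilinearCochain t) X z
      = ∑ k : Fin (n + 1), (-1 : K) ^ (k : ℕ) •
        (∑ j ∈ Finset.univ.filter (fun j : Fin n => k < k.succAbove j),
            F (Function.update (fun i => X (k.succAbove i)) j
              (actPair (TensorProduct.lift t (X k)) (X (k.succAbove j)))) z
          + F (fun i => X (k.succAbove i)) (TensorProduct.lift t (X k) z)) := by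
  have hins : ∀ (s : Fin n) (k : Fin (n + 1)),
      ((insertPair h F (trilinearCochain t) s).domDomCongr (movePerm s.castSucc k)) X
        = F (Function.update (fun i => X (k.succAbove i)) s
            (actPair (TensorProduct.lift t (X k)) (X (k.succAbove s)))) := by
    intro s k
    change F (pairArgs h _ s fun i => X (movePerm s.castSucc k i)) = _
    congr 1
    -- The inner pair occupies position `s`, so the pair acted on sits at `s + 1`, which is index
    -- `s` once position `s` is skipped.
    have hs : ∀ (hn : (s : ℕ) + 1 < n + 1), (⟨s + 1, hn⟩ : Fin (n + 1)) = s.castSucc.succAbove s :=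
      fun hn => by ext; simp
    funext j
    rcases lt_trichotomy j s with hj | rfl | hj
    · rw [Function.update_of_ne hj.ne, pairArgs, if_pos hj, ← movePerm_succAbove s.castSucc k j,
        Fin.succAbove_of_castSucc_lt _ _ (by simpa using hj)]
      rfl
    · rw [Function.update_self, pairArgs, if_neg (lt_irrefl _), if_pos rfl,
        ← movePerm_succAbove j.castSucc k j, hs]
      change actPair (TensorProduct.lift t (X (movePerm j.castSucc k j.castSucc))) _ = _
      rw [movePerm_self]
    · rw [Function.update_of_ne hj.ne', pairArgs, if_neg hj.not_gt, if_neg hj.ne',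
        ← movePerm_succAbove s.castSucc k j,
        Fin.succAbove_of_le_castSucc _ _ (by simpa using hj.le)]
      rfl
  have hlast : ∀ k : Fin (n + 1),
      ((insertLast h F (trilinearCochain t)).domDomCongr (movePerm (Fin.last n) k)) X z
        = F (fun i => X (k.succAbove i)) (TensorProduct.lift t (X k) z) := by
    intro k
    change F (fun i => X (movePerm (Fin.last n) k i.castSucc))
      (TensorProduct.lift t (X (movePerm (Fin.last n) k (Fin.last n))) z) = _
    rw [movePerm_self]
    congr 2
    funext i
    rw [← movePerm_succAbove (Fin.last n) k i, Fin.succAbove_last]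
  have hsh : ∀ (s : Fin n) (g : Equiv.Perm (Fin (n + 1)) → Cochain K V V (n + 1)),
      ∑ σ ∈ Finset.univ.filter (fun σ : Equiv.Perm (Fin (n + 1)) => IsShuffle s 1 σ), g σ
        = ∑ k ∈ Finset.Iic s.castSucc, g (movePerm s.castSucc k) :=
    fun s g => sum_isShuffle_one_right s.castSucc g
  have hsl : ∀ (g : Equiv.Perm (Fin (n + 1)) → Cochain K V V (n + 1)),
      ∑ σ ∈ Finset.univ.filter (fun σ : Equiv.Perm (Fin (n + 1)) => IsShuffle n 1 σ), g σ
        = ∑ k, g (movePerm (Fin.last n) k) := fun g => by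
    refine (sum_isShuffle_one_right (Fin.last n) g).trans ?_
    simp [← Fin.top_eq_last]
  -- The slot sign `(-1)^m` cancels against the shuffle sign `(-1)^{m+k}`, leaving a sign
  -- independent of the slot.
  have hsign : ∀ m k : ℕ, (-1 : K) ^ m * (-1) ^ (m + k) = (-1) ^ k := fun m k => by
    rw [← pow_add, ← add_assoc, pow_add, Even.neg_one_pow ⟨m, rfl⟩, one_mul]
  simp only [circ, mul_one, hsh, hsl, sgn_movePerm, add_apply, LinearMap.add_apply, sum_apply,
    LinearMap.sum_apply, smul_apply, LinearMap.smul_apply, hins, hlast, Fin.val_castSucc,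
    Fin.val_last, Finset.smul_sum, smul_smul, hsign, smul_add, Finset.sum_add_distrib]
  congr 1
  -- The shuffle range `k ≤ s.castSucc` is the condition `k < k.succAbove s` that pair `s` comes
  -- after the removed pair `k`.
  refine Finset.sum_comm' fun s k => ?_
  simp [Fin.lt_succAbove_iff_le_castSucc]

end Circ

/-! ### Bracketing a trilinear map with a linear map -/

section AdLinear

variable {K V : Type*} [Field K] [AddCommGroup V] [Module K V]

/-- The trilinear map `[t, A]`, for `t` trilinear and `A` linear. -/
def adLinear (A : V →ₗ[K] V) (t : V →ₗ[K] V →ₗ[K] V →ₗ[K] V) : V →ₗ[K] V →ₗ[K] V →ₗ[K] V :=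
  mk₃ (fun x y z => t (A x) y z + t x (A y) z + t x y (A z) - A (t x y z))
    (by intros; simp; abel) (by intros; simp [smul_add, smul_sub])
    (by intros; simp; abel) (by intros; simp [smul_add, smul_sub])
    (by intros; simp; abel) (by intros; simp [smul_add, smul_sub])

@[simp] theorem adLinear_apply (A : V →ₗ[K] V) (t : V →ₗ[K] V →ₗ[K] V →ₗ[K] V) (x y z : V) :
    adLinear A t x y z = t (A x) y z + t x (A y) z + t x y (A z) - A (t x y z) := rfl

theorem trilinearCochain_ext {F G : Cochain K V V 1}
    (h : ∀ x y z, F (fun _ => x ⊗ₜ y) z = G (fun _ => x ⊗ₜ y) z) : F = G := by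
  have h' : (MultilinearMap.ofSubsingleton K (V ⊗[K] V) (V →ₗ[K] V) (0 : Fin 1)).symm F
      = (MultilinearMap.ofSubsingleton K (V ⊗[K] V) (V →ₗ[K] V) (0 : Fin 1)).symm G :=
    TensorProduct.ext' fun x y => LinearMap.ext fun z => h x y z
  exact (MultilinearMap.ofSubsingleton K (V ⊗[K] V) (V →ₗ[K] V) (0 : Fin 1)).symm.injective h'

theorem trilinearCochain_add (s t : V →ₗ[K] V →ₗ[K] V →ₗ[K] V) :
    trilinearCochain (s + t) = trilinearCochain s + trilinearCochain t :=
  trilinearCochain_ext fun _ _ _ => rfl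

theorem trilinearCochain_smul (c : K) (t : V →ₗ[K] V →ₗ[K] V →ₗ[K] V) :
    trilinearCochain (c • t) = c • trilinearCochain t :=
  trilinearCochain_ext fun _ _ _ => rfl

/-- The case `n = 0` of the two composition formulas: `A` goes into each input of `t` in turn, minus
`A` applied to the output. -/
theorem bracket_trilinearCochain_linearCochain (h : 1 + 0 = 1) (t : V →ₗ[K] V →ₗ[K] V →ₗ[K] V)
    (A : V →ₗ[K] V) :
    bracket h (trilinearCochain t) (linearCochain A) = trilinearCochain (adLinear A t) := by
  refine trilinearCochain_ext fun x y z => ?_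
  have h₁ := circ_trilinearCochain_left (n := 0) h t (linearCochain A) (fun _ => x ⊗ₜ y) z
  have h₂ := circ_trilinearCochain_right (n := 0) rfl t (linearCochain A) (fun _ => x ⊗ₜ y) z
  have e : bracket h (trilinearCochain t) (linearCochain A) (fun _ => x ⊗ₜ y) z
      = circ h (trilinearCochain t) (linearCochain A) (fun _ => x ⊗ₜ y) z
        - ((-1 : K) ^ (1 * 0) • circ (p := 0) (q := 1) rfl (linearCochain A) (trilinearCochain t)
            (fun _ => x ⊗ₜ y) z) := rfl
  simp only [zero_add] at h₁ h₂
  rw [e, h₁, h₂]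
  simp [linearCochain, trilinearCochain]

end AdLinear

/-! ### The twisted differential as the Yamaguti coboundary -/

section Twist

variable {K L M : Type*} [Field K] [AddCommGroup L] [Module K L] [AddCommGroup M] [Module K M]
  {br : L →ₗ[K] L →ₗ[K] L →ₗ[K] L} {θ : L →ₗ[K] L →ₗ[K] M →ₗ[K] M}
  {H : L →ₗ[K] L →ₗ[K] L →ₗ[K] M} {T : M →ₗ[K] L}

/-- The trilinear map `(x + u, y + v, z + w) ↦ ρ(v, w) x - ρ(u, w) y + D(u, v) z + β(u, v, w)`
on `L ⊕ M`. -/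
def moduleExtension (β : M →ₗ[K] M →ₗ[K] M →ₗ[K] M) (ρ : M →ₗ[K] M →ₗ[K] L →ₗ[K] L) :
    L × M →ₗ[K] L × M →ₗ[K] L × M →ₗ[K] L × M :=
  mk₃ (fun a b c => (ρ b.2 c.2 a.1 - ρ a.2 c.2 b.1 + dOp ρ a.2 b.2 c.1, β a.2 b.2 c.2))
    (by intros; ext <;> simp; abel) (by intros; ext <;> simp [smul_add, smul_sub])
    (by intros; ext <;> simp; abel) (by intros; ext <;> simp [smul_add, smul_sub])
    (by intros; ext <;> simp; abel) (by intros; ext <;> simp [smul_add, smul_sub])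

theorem moduleExtension_apply (β : M →ₗ[K] M →ₗ[K] M →ₗ[K] M) (ρ : M →ₗ[K] M →ₗ[K] L →ₗ[K] L)
    (a b c : L × M) : moduleExtension β ρ a b c
      = (ρ b.2 c.2 a.1 - ρ a.2 c.2 b.1 + dOp ρ a.2 b.2 c.1, β a.2 b.2 c.2) := rfl

/-- `T : M → L` as an endomorphism of `L ⊕ M`. -/
def extendLinear (T : M →ₗ[K] L) : L × M →ₗ[K] L × M :=
  LinearMap.inl K L M ∘ₗ T ∘ₗ LinearMap.snd K L M

@[simp] theorem extendLinear_apply (a : L × M) : extendLinear T a = (T a.2, 0) := rfl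

/-- `T` turns an `M`-input into an `L`-input, or an `M`-output into an `L`-output with a minus sign,
and it cannot be used twice in one place. Output in `M` needs `T` only on inputs and gives the
induced bracket; output in `L` gives the bracket of `L` with two `T`-inputs, and `-T` of the `θ` and
`H` terms, which assemble into `θ_T`. -/
theorem adLinear_semidirect_add_cocycleExt [CharZero K] (hbr : IsLieTripleSystem br)
    (hH : IsThreeCocycle br θ H) :
    (1 / 2 : K) • adLinear (extendLinear T) (adLinear (extendLinear T) (semidirect br θ))
      + (1 / 6 : K) • adLinear (extendLinear T) (adLinear (extendLinear T)
          (adLinear (extendLinear T) (cocycleExt H)))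
      = moduleExtension (inducedBracket θ H T) (inducedRep br θ H T) := by
  -- The factor 2 counts the orders in which two distinct slots receive `T`.
  have key₂ : ∀ a b c, adLinear (extendLinear T) (adLinear (extendLinear T) (semidirect br θ)) a b c
      = (2 : K) • (br a.1 (T b.2) (T c.2) + br (T a.2) b.1 (T c.2) + br (T a.2) (T b.2) c.1
          - T (dOp θ a.1 (T b.2) c.2 - θ a.1 (T c.2) b.2
            + (dOp θ (T a.2) b.1 c.2 + θ b.1 (T c.2) a.2)
            + (θ (T b.2) c.1 a.2 - θ (T a.2) c.1 b.2)),
          θ (T b.2) (T c.2) a.2 - θ (T a.2) (T c.2) b.2 + dOp θ (T a.2) (T b.2) c.2) := by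
    intro a b c
    ext
    · simp [semidirect]
      module
    · simp [semidirect]
      module
  -- Likewise 6 = 3! orders: `T` either on all three inputs of `H`, or on two inputs and the output.
  have key₃ : ∀ a b c, adLinear (extendLinear T) (adLinear (extendLinear T)
        (adLinear (extendLinear T) (cocycleExt H))) a b c
      = (6 : K) • (- T (H a.1 (T b.2) (T c.2) + H (T a.2) b.1 (T c.2) + H (T a.2) (T b.2) c.1),
          H (T a.2) (T b.2) (T c.2)) := by
    intro a b c
    ext
    · simp [cocycleExt]
      module
    · simp [cocycleExt]
      module
  refine LinearMap.ext fun a => LinearMap.ext fun b => LinearMap.ext fun c => ?_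
  simp only [LinearMap.add_apply, LinearMap.smul_apply, key₂, key₃, smul_smul]
  have e₂ : (1 / 2 * 2 : K) = 1 := by norm_num
  have e₃ : (1 / 6 * 6 : K) = 1 := by norm_num
  rw [e₂, e₃, one_smul, one_smul, moduleExtension_apply]
  -- `θ_T` has its `L`-vector in the first slot of `br` and `H`; these symmetries move it there from
  -- the second and third slots.
  have hb₁ := hbr.swap (T a.2) b.1 (T c.2)
  have hb₂ := hbr.cyclic (T a.2) (T b.2) c.1
  have hb₃ := hbr.swap c.1 (T b.2) (T a.2)
  have hh₁ := congrArg T (hH.swap (T a.2) b.1 (T c.2))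
  have hh₂ := congrArg T (hH.cyclic (T a.2) (T b.2) c.1)
  have hh₃ := congrArg T (hH.swap c.1 (T b.2) (T a.2))
  ext
  · simp only [inducedRep, mk₃_apply, dOp_apply, map_add, map_sub, map_neg, map_zero,
      Prod.fst_add] at *
    linear_combination (norm := abel) hb₂ + hb₁ - hb₃ - hh₂ - hh₁ + hh₃
  · simp only [inducedBracket, mk₃_apply, Prod.snd_add]

theorem bracket_add_left {p q N : ℕ} (h : p + q = N) {V : Type*} [AddCommGroup V] [Module K V]
    (P P' : Cochain K V V p) (Q : Cochain K V V q) :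
    bracket h (P + P') Q = bracket h P Q + bracket h P' Q := by
  simp only [bracket, circ_add_right, circ_add_left, smul_add]
  abel

theorem bracket_smul_left {p q N : ℕ} (h : p + q = N) {V : Type*} [AddCommGroup V] [Module K V]
    (c : K) (P : Cochain K V V p) (Q : Cochain K V V q) :
    bracket h (c • P) Q = c • bracket h P Q := by
  simp only [bracket, circ_smul_right, circ_smul_left, smul_sub]
  rw [smul_comm c]

/-- All copies of `T` are bracketed in before `F`, so they act on degree 1 cochains only; linearity
of the bracket in its first factor then collects the two terms. -/
theorem l₁Twisted_eq_bracket [CharZero K] (hbr : IsLieTripleSystem br)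
    (hH : IsThreeCocycle br θ H) {n : ℕ} (h : 1 + n = n + 1) (F : Cochain K (L × M) (L × M) n) :
    l₁Twisted br θ H T n F = bracket h
      (trilinearCochain (moduleExtension (inducedBracket θ H T) (inducedRep br θ H T))) F := by
  have h₁ : ∀ t : L × M →ₗ[K] L × M →ₗ[K] L × M →ₗ[K] L × M,
      bracket (rfl : 1 + 0 = 1) (trilinearCochain t) (extendCochain (linearCochain T))
        = trilinearCochain (adLinear (extendLinear T) t) :=
    fun t => bracket_trilinearCochain_linearCochain rfl t (extendLinear T)
  have h₃ : l₃ br θ (p := 0) (q := 0) (r := n) (N := n + 1) (by omega)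
      (extendCochain (linearCochain T)) (extendCochain (linearCochain T)) F
      = bracket h (trilinearCochain (adLinear (extendLinear T) (adLinear (extendLinear T)
          (semidirect br θ)))) F := by
    rw [← h₁, ← h₁]
    rfl
  have h₄ : l₄ H (p := 0) (q := 0) (r := 0) (s := n) (N := n + 1) (by omega)
      (extendCochain (linearCochain T)) (extendCochain (linearCochain T))
      (extendCochain (linearCochain T)) F
      = bracket h (trilinearCochain (adLinear (extendLinear T) (adLinear (extendLinear T)
          (adLinear (extendLinear T) (cocycleExt H))))) F := by
    rw [← h₁, ← h₁, ← h₁]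
    rfl
  change (1 / 2 : K) • l₃ br θ _ _ _ F + (1 / 6 : K) • l₄ H _ _ _ _ F = _
  rw [h₃, h₄, ← adLinear_semidirect_add_cocycleExt hbr hH, trilinearCochain_add,
    trilinearCochain_smul, trilinearCochain_smul, bracket_add_left, bracket_smul_left,
    bracket_smul_left]

/-- The projection `L ⊕ M → M` on pairs of arguments. -/
def sndPair (K L M : Type*) [Field K] [AddCommGroup L] [Module K L] [AddCommGroup M] [Module K M] :
    (L × M) ⊗[K] (L × M) →ₗ[K] M ⊗[K] M :=
  TensorProduct.map (LinearMap.snd K L M) (LinearMap.snd K L M)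

theorem extendCochain_apply {n : ℕ} (f : Cochain K M L n) (X : Fin n → (L × M) ⊗[K] (L × M))
    (z : L × M) : extendCochain f X z = (f (fun i => sndPair K L M (X i)) z.2, 0) := rfl

variable (β : M →ₗ[K] M →ₗ[K] M →ₗ[K] M) (ρ : M →ₗ[K] M →ₗ[K] L →ₗ[K] L)

theorem lift_moduleExtension_snd (Y : (L × M) ⊗[K] (L × M)) (z : L × M) :
    (TensorProduct.lift (moduleExtension β ρ) Y z).2
      = TensorProduct.lift β (sndPair K L M Y) z.2 := by
  induction Y with
  | zero => simp
  | tmul a b => rfl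
  | add Y Y' h h' => simp only [map_add, LinearMap.add_apply, Prod.snd_add, h, h']

/-- A vector of `L` in one slot removes the `β` component and isolates a single `ρ` or `D` term.
This is what separates the terms of the coboundary below. -/
theorem lift_moduleExtension_inl (Y : (L × M) ⊗[K] (L × M)) (x : L) :
    TensorProduct.lift (moduleExtension β ρ) Y (x, 0)
      = (TensorProduct.lift (dOp ρ) (sndPair K L M Y) x, 0) := by
  induction Y with
  | zero => simp only [map_zero, LinearMap.zero_apply, Prod.mk_zero_zero]
  | tmul a b => simp [moduleExtension_apply, sndPair]
  | add Y Y' h h' => simp only [map_add, LinearMap.add_apply, h, h', Prod.mk_add_mk, add_zero]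

theorem sndPair_actPair (Y X : (L × M) ⊗[K] (L × M)) :
    sndPair K L M (actPair (TensorProduct.lift (moduleExtension β ρ) Y) X)
      = actPair (TensorProduct.lift β (sndPair K L M Y)) (sndPair K L M X) := by
  induction X with
  | zero => simp
  | tmul a b =>
    have h := lift_moduleExtension_snd β ρ Y
    simp only [sndPair] at h
    simp [sndPair, h]
  | add X X' h h' => simp only [map_add, h, h']

theorem lift_moduleExtension_actPair (g : M →ₗ[K] L) (Y : (L × M) ⊗[K] (L × M)) (z : L × M) :
    TensorProduct.lift (moduleExtension β ρ) (actPair (extendLinear g) Y) z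
      = (thetaPart ρ (sndPair K L M Y) g z.2, 0) := by
  induction Y with
  | zero => simp only [map_zero, LinearMap.zero_apply, Prod.mk_zero_zero]
  | tmul a b => simp [moduleExtension_apply, sndPair, sub_eq_add_neg]
  | add Y Y' h h' => simp only [map_add, LinearMap.add_apply, h, h', Prod.mk_add_mk, add_zero]

/-- The extended `f` takes values in `L` and sees only `M`-components. So `f` inside
`moduleExtension` yields the `ρ` and `D` terms, while `moduleExtension` inside `f` is seen only
through `β`. -/
theorem bracket_moduleExtension_extendCochain {n : ℕ} (h : 1 + n = n + 1) (f : Cochain K M L n) :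
    bracket h (trilinearCochain (moduleExtension β ρ)) (extendCochain f)
      = extendCochain (yamagutiCoboundary β ρ n f) := by
  refine MultilinearMap.ext fun X => LinearMap.ext fun z => ?_
  have e : bracket h (trilinearCochain (moduleExtension β ρ)) (extendCochain f) X z
      = circ h (trilinearCochain (moduleExtension β ρ)) (extendCochain f) X z
        - (-1 : K) ^ (1 * n) • circ rfl (extendCochain f)
            (trilinearCochain (moduleExtension β ρ)) X z := rfl
  have hupd : ∀ (k : Fin (n + 1)) (j : Fin n) (Z : (L × M) ⊗[K] (L × M)),
      (fun i => sndPair K L M (Function.update (fun i => X (k.succAbove i)) j Z i))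
        = Function.update (fun i => sndPair K L M (X (k.succAbove i))) j (sndPair K L M Z) := by
    intro k j Z
    funext i
    by_cases hi : i = j
    · subst hi; simp
    · simp [Function.update_of_ne hi]
  -- With its `n` pairs filled in, `f` is a linear map `M → L`, so its action on the last pair
  -- produces the `thetaPart` term.
  have hext : extendCochain f (fun i => X i.castSucc)
      = extendLinear (f fun i => sndPair K L M (X i.castSucc)) := rfl
  have hb : yamagutiCoboundary β ρ n f
      = LinearMap.uncurryMid (Fin.last n) (postComp f ∘ₗ thetaPart ρ)
        + ∑ k : Fin (n + 1), (-1 : K) ^ (n + (k : ℕ)) • LinearMap.uncurryMid k (pairPart β ρ f k) :=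
    rfl
  rw [e, circ_trilinearCochain_left, circ_trilinearCochain_right, hext,
    lift_moduleExtension_actPair]
  simp only [extendCochain_apply, hb, lift_moduleExtension_inl, lift_moduleExtension_snd, hupd,
    sndPair_actPair]
  ext
  · simp only [add_apply,
      LinearMap.add_apply, sum_apply, LinearMap.sum_apply, smul_apply,
      LinearMap.smul_apply, LinearMap.uncurryMid_apply, LinearMap.comp_apply, postComp_apply,
      pairPart_apply, Prod.fst_sub, Prod.fst_add, Prod.smul_fst, Prod.fst_sum, Fin.removeNth_apply]
    rw [add_sub_assoc, Finset.smul_sum, ← Finset.sum_sub_distrib]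
    congr 1
    · have hr : (Fin.last n).removeNth (fun i => sndPair K L M (X i))
          = fun i => sndPair K L M (X i.castSucc) := by
        funext i
        rw [Fin.removeNth_apply, Fin.succAbove_last]
      rw [hr]
    · refine Finset.sum_congr rfl fun k _ => ?_
      -- The factor `(-1)^{1·n}` of the graded bracket turns `(-1)^k` into `(-1)^{n+k}`, the sign of
      -- the `D` term with the same `k`.
      rw [smul_smul, one_mul, ← pow_add, ← smul_sub, sub_sub]
      rfl
  · simp [Prod.snd_sum]

theorem restrictCochain_extendCochain {n : ℕ} (f : Cochain K M L n) :
    restrictCochain (extendCochain f) = f := by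
  refine MultilinearMap.ext fun X => LinearMap.ext fun z => ?_
  change f (fun i => TensorProduct.map (LinearMap.snd K L M) (LinearMap.snd K L M)
    (TensorProduct.map (LinearMap.inr K L M) (LinearMap.inr K L M) (X i))) z = f X z
  congr 2
  funext i
  rw [← LinearMap.comp_apply, ← TensorProduct.map_comp, LinearMap.snd_comp_inr,
    TensorProduct.map_id, LinearMap.id_apply]

theorem l₁Twisted_extendCochain [CharZero K] (hbr : IsLieTripleSystem br)
    (hH : IsThreeCocycle br θ H) (n : ℕ) (f : Cochain K M L n) :
    l₁Twisted br θ H T n (extendCochain f) = extendCochain (lambdaT br θ H T n f) := by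
  rw [l₁Twisted_eq_bracket hbr hH (add_comm 1 n), bracket_moduleExtension_extendCochain]
  rfl

theorem twistedDifferential_eq_lambdaT [CharZero K] (hbr : IsLieTripleSystem br)
    (hH : IsThreeCocycle br θ H) : twistedDifferential br θ H T = lambdaT br θ H T := by
  funext n
  refine LinearMap.ext fun f => ?_
  change restrictCochain (l₁Twisted br θ H T n (extendCochain f)) = _
  rw [l₁Twisted_extendCochain hbr hH, restrictCochain_extendCochain]

end Twist

end LTS

theorem mainTheorem3 {K L M : Type*} [Field K] [CharZero K]
    [AddCommGroup L] [Module K L] [AddCommGroup M] [Module K M]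
    (br : L →ₗ[K] L →ₗ[K] L →ₗ[K] L) (hbr : LTS.IsLieTripleSystem br)
    (θ : L →ₗ[K] L →ₗ[K] M →ₗ[K] M) (hθ : LTS.IsRepresentation br θ)
    (H : L →ₗ[K] L →ₗ[K] L →ₗ[K] M) (hH : LTS.IsThreeCocycle br θ H)
    (T : M →ₗ[K] L) (hT : LTS.IsGeneralizedReynolds br θ H T) :
    -- `(M, [·,·,·]_T)` is a Lie triple system and `(L, θ_T)` is a representation of it
    LTS.IsLieTripleSystem (LTS.inducedBracket θ H T) ∧
    LTS.IsRepresentation (LTS.inducedBracket θ H T) (LTS.inducedRep br θ H T) ∧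
    -- `l₁ᵀ` maps the image of `C*(M, L)` in `C*(L ⊕ M, L ⊕ M)` to itself, where it is `Λ_T`
    (∀ (n : ℕ) (f : LTS.Cochain K M L n),
      LTS.l₁Twisted br θ H T n (LTS.extendCochain f)
        = LTS.extendCochain (LTS.lambdaT br θ H T n f)) ∧
    -- `d_T f = Λ_T f` for every multilinear `f`
    (∀ (n : ℕ) (f : LTS.Cochain K M L n),
      LTS.twistedDifferential br θ H T n f = LTS.lambdaT br θ H T n f) ∧
    -- both operators have the same cohomology, for either space of cochains
    (∀ C : ∀ n, Submodule K (LTS.Cochain K M L n),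
      (C = LTS.yamagutiCochains K M L ∨ C = LTS.alternatingCochains K M L) → ∀ n : ℕ,
        LTS.coboundaries C (LTS.twistedDifferential br θ H T) n
          = LTS.coboundaries C (LTS.lambdaT br θ H T) n ∧
        ∃ hZ : LTS.cocycles C (LTS.twistedDifferential br θ H T) n
            = LTS.cocycles C (LTS.lambdaT br θ H T) n,
          ∃ e : LTS.Cohomology C (LTS.twistedDifferential br θ H T) n
              ≃ₗ[K] LTS.Cohomology C (LTS.lambdaT br θ H T) n,
            ∀ z : LTS.cocycles C (LTS.twistedDifferential br θ H T) n,
              e (LTS.cohomologyClass C (LTS.twistedDifferential br θ H T) n z)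
                = LTS.cohomologyClass C (LTS.lambdaT br θ H T) n ⟨z, hZ ▸ z.2⟩) := by
  have hd := LTS.twistedDifferential_eq_lambdaT (T := T) hbr hH
  refine ⟨LTS.isLieTripleSystem_inducedBracket hbr hθ hH hT,
    LTS.isRepresentation_inducedRep hbr hθ hH hT,
    LTS.l₁Twisted_extendCochain hbr hH, fun n f => by rw [hd], fun C _ n => ?_⟩
  -- Once the two families of operators are identified, the isomorphism is the identity.
  rw [hd]
  exact ⟨rfl, rfl, LinearEquiv.refl K _, fun _ => rfl⟩
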